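/- All representations are finite-dimensional and real. For a partition $\lambda$ of $n$ let $V_\lambda$ be the corresponding irreducible representation of the symmetric group $\mathfrak S_n$ (the left ideal of $\mathbb R[\mathfrak S_n]$ generated by a Young symmetrizer of shape $\lambda$). A representation $V$ of $\mathfrak S_n$ is called *short* if each of its irreducible subrepresentations is isomorphic to $V_\lambda$ for some partition $\lambda$ of $n$ of length at most $2$. For a real vector space $V$ let $\operatorname{Sym}_2(V)\subset V\otimes V$ be the space of symmetric tensors; $t\in\operatorname{Sym}_2(V)$ is positive semidefinite, $t\succeq 0$, if $(f\otimes f)(t)\ge 0$ for every linear functional $f$ on $V$. A linear map $P:W\to V$ induces $\mathrm S_2P:\operatorname{Sym}_2(W)\to\operatorname{Sym}_2(V)$. The group $\mathfrak S_n$ acts on $\mathbb R^n$ by permuting coordinates and embeds into the orthogonal group $\operatorname O(n)$ as the permutation matrices, and $\operatorname O(n)$ acts on the space $\operatorname{Sym}_2(\mathbb R^n)$ of real symmetric $n\times n$ matrices by $X\mapsto UXU^{T}$. For such $X$ let $\lambda(X)\in\mathbb R^n$ be its vector of eigenvalues (with multiplicities). A subset $C$ of a real vector space $E$ is a *spectrahedral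 cone* if $C=\{x\in E: A(x)\succeq 0\}$ for a linear map $A$ from $E$ to the real symmetric matrices of some size. **Theorem 2.2.** Let $V$ be a short representation of $\mathfrak S_n$. (1) Let $\varphi:\mathbb R^n\to\operatorname{Sym}_2(V)$ be an $\mathfrak S_n$-linear map and let $S=\{a\in\mathbb R^n:\varphi(a)\succeq 0\}$ be the preimage of the positive semidefinite cone. Then the spectral set $\Lambda(S)=\{X\in\operatorname{Sym}_2(\mathbb R^n):\lambda(X)\in S\}$ is a spectrahedral cone. (2) More precisely, there are a finite-dimensional continuous representation $W$ of $\operatorname O(n)$ and an $\mathfrak S_n$-linear surjective map $P:W\to V$, both depending only on $V$, such that for every $\mathfrak S_n$-linear map $\varphi:\mathbb R^n\to\operatorname{Sym}_2(V)$ there is an $\operatorname O(n)$-linear map $\Phi:\operatorname{Sym}_2(\mathbb R^n)\to\operatorname{Sym}_2(W)$ with $(\mathrm S_2P)(\Phi(\operatorname{diag}(a)))=\varphi(a)$ for all $a\in\mathbb R^n$, and such that for every $X\in\operatorname{Sym}_2(\mathbb R^n)$, $\Phi(X)\succeq 0$ if and only if $\varphi(\lambda(X))\succeq 0$. -/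

import Mathlib

open scoped TensorProduct

namespace SpectralLMI

/-! ### Irreducible representations of the symmetric group -/

/-- The Young diagram of a partition `p` of `n`: its rows are the parts of `p` in weakly
decreasing order. -/
def youngDiagram {n : ℕ} (p : n.Partition) : YoungDiagram :=
  YoungDiagram.ofRowLens (p.parts.sort (· ≥ ·)) (p.parts.pairwise_sort (· ≥ ·)).sortedGE

/-- A Young tableau of shape `p`: a bijective labelling of the boxes of the diagram of `p` by
`n` labels. -/
abbrev Tableau {n : ℕ} (p : n.Partition) : Type := (youngDiagram p).cells ≃ Fin n

/-- The row of the tableau in which the label `i` stands. -/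
def Tableau.row {n : ℕ} {p : n.Partition} (T : Tableau p) (i : Fin n) : ℕ := (T.symm i).1.1

/-- The column of the tableau in which the label `i` stands. -/
def Tableau.col {n : ℕ} {p : n.Partition} (T : Tableau p) (i : Fin n) : ℕ := (T.symm i).1.2

/-- The sum, in the real group algebra, of all permutations preserving each row of `T`. -/
noncomputable def Tableau.rowSum {n : ℕ} {p : n.Partition} (T : Tableau p) :
    MonoidAlgebra ℝ (Equiv.Perm (Fin n)) :=
  ∑ g : Equiv.Perm (Fin n) with ∀ i, T.row (g i) = T.row i, MonoidAlgebra.of ℝ _ g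

/-- The signed sum, in the real group algebra, of all permutations preserving each column
of `T`. -/
noncomputable def Tableau.colSum {n : ℕ} {p : n.Partition} (T : Tableau p) :
    MonoidAlgebra ℝ (Equiv.Perm (Fin n)) :=
  ∑ g : Equiv.Perm (Fin n) with ∀ i, T.col (g i) = T.col i,
    ((Equiv.Perm.sign g : ℤ) : ℝ) • MonoidAlgebra.of ℝ _ g

/-- The Young symmetrizer `c = a * b` of a tableau. -/
noncomputable def Tableau.youngSymmetrizer {n : ℕ} {p : n.Partition} (T : Tableau p) :
    MonoidAlgebra ℝ (Equiv.Perm (Fin n)) :=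
  T.rowSum * T.colSum

/-- The irreducible representation `V_p` of the symmetric group: left multiplication on the left
ideal of the real group algebra generated by the Young symmetrizer. Up to isomorphism it depends
only on the shape `p` of `T`. -/
noncomputable def Tableau.spechtRep {n : ℕ} {p : n.Partition} (T : Tableau p) :
    Representation ℝ (Equiv.Perm (Fin n))
      (Ideal.span {T.youngSymmetrizer} : Ideal (MonoidAlgebra ℝ (Equiv.Perm (Fin n)))) :=
  Representation.ofModule' _

/-- A representation of the symmetric group is short if each of its irreducible
subrepresentations is isomorphic to `V_p` for a partition `p` of length at most two. -/
def IsShort {n : ℕ} {V : Type*} [AddCommGroup V] [Module ℝ V]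
    (ρ : Representation ℝ (Equiv.Perm (Fin n)) V) : Prop :=
  ∀ U : Subrepresentation ρ, U.toRepresentation.IsIrreducible →
    ∃ p : n.Partition, p.parts.card ≤ 2 ∧
      ∃ T : Tableau p, Nonempty (U.toRepresentation.Equiv T.spechtRep)

/-! ### Symmetric squares and positive semidefiniteness -/

/-- `Sym_2(V)`, the space of symmetric tensors in `V ⊗ V`. -/
def SymSquare (V : Type*) [AddCommGroup V] [Module ℝ V] : Submodule ℝ (V ⊗[ℝ] V) where
  carrier := {t | TensorProduct.comm ℝ V V t = t}
  add_mem' {s t} hs ht := by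
    simp only [Set.mem_ofPred_eq, map_add] at hs ht ⊢
    rw [hs, ht]
  zero_mem' := by simp
  smul_mem' c t ht := by
    simp only [Set.mem_ofPred_eq, map_smul] at ht ⊢
    rw [ht]

theorem comm_map {V W : Type*} [AddCommGroup V] [Module ℝ V] [AddCommGroup W] [Module ℝ W]
    (f : V →ₗ[ℝ] W) (t : V ⊗[ℝ] V) :
    TensorProduct.comm ℝ W W (TensorProduct.map f f t)
      = TensorProduct.map f f (TensorProduct.comm ℝ V V t) := by
  induction t with
  | zero => simp
  | tmul x y => simp
  | add x y hx hy => simp only [map_add, hx, hy]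

/-- The linear map `Sym_2(V) → Sym_2(W)` induced by a linear map `f : V → W`, the restriction
of `f ⊗ f`. -/
noncomputable def SymSquare.map {V W : Type*} [AddCommGroup V] [Module ℝ V] [AddCommGroup W]
    [Module ℝ W] (f : V →ₗ[ℝ] W) : SymSquare V →ₗ[ℝ] SymSquare W :=
  (TensorProduct.map f f).restrict fun t ht =>
    (comm_map f t).trans (congrArg (TensorProduct.map f f) ht)

/-- The representation on `Sym_2(V)` induced by a representation on `V`. -/
noncomputable def symSquareRep {G V : Type*} [Group G] [AddCommGroup V] [Module ℝ V]
    (ρ : Representation ℝ G V) : Representation ℝ G (SymSquare V) where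
  toFun g := SymSquare.map (ρ g)
  map_one' := by
    ext t
    simp [SymSquare.map, Module.End.one_eq_id]
  map_mul' g h := by
    apply LinearMap.ext
    intro t
    apply Subtype.ext
    change TensorProduct.map (ρ (g * h)) (ρ (g * h)) t.1
      = TensorProduct.map (ρ g) (ρ g) (TensorProduct.map (ρ h) (ρ h) t.1)
    rw [map_mul, Module.End.mul_eq_comp, TensorProduct.map_comp, LinearMap.comp_apply]

/-- An element `t` of `Sym_2(V)` is positive semidefinite if `(f ⊗ f)(t) ≥ 0` for every linear
functional `f` on `V`, that is, if the quadratic form on the dual of `V` given by `t` is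
nonnegative. -/
def IsPSD {V : Type*} [AddCommGroup V] [Module ℝ V] (t : SymSquare V) : Prop :=
  ∀ f : Module.Dual ℝ V, 0 ≤ TensorProduct.dualDistrib ℝ V V (f ⊗ₜ[ℝ] f) t.1

/-! ### Symmetric matrices, eigenvalues, spectrahedral cones -/

/-- The space of real symmetric `n × n` matrices. -/
def SymMat (n : ℕ) : Submodule ℝ (Matrix (Fin n) (Fin n) ℝ) where
  carrier := {X | X.IsSymm}
  add_mem' hX hY := hX.add hY
  zero_mem' := Matrix.isSymm_zero
  smul_mem' c _ hX := hX.smul c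

theorem SymMat.isHermitian {n : ℕ} (X : SymMat n) : X.1.IsHermitian :=
  (Matrix.conjTranspose_eq_transpose_of_trivial X.1).trans X.2

/-- The vector `λ(X)` of eigenvalues of a symmetric matrix, with multiplicities. -/
noncomputable def eigenvalueVector {n : ℕ} (X : SymMat n) : Fin n → ℝ :=
  (SymMat.isHermitian X).eigenvalues

/-- The diagonal matrix with diagonal `a`. -/
def diag {n : ℕ} (a : Fin n → ℝ) : SymMat n := ⟨Matrix.diagonal a, Matrix.isSymm_diagonal a⟩

/-- The spectral set `Λ(S)`: all symmetric matrices whose vector of eigenvalues lies in `S`. -/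
def spectralSet {n : ℕ} (S : Set (Fin n → ℝ)) : Set (SymMat n) := {X | eigenvalueVector X ∈ S}

/-- A subset of a real vector space is a spectrahedral cone if it is the solution set of a
homogeneous linear matrix inequality `A(x) ⪰ 0`, where `A` is a linear map to the real symmetric
matrices of some size. -/
def IsSpectrahedralCone {E : Type*} [AddCommGroup E] [Module ℝ E] (C : Set E) : Prop :=
  ∃ (N : ℕ) (A : E →ₗ[ℝ] SymMat N), C = {x | (A x).1.PosSemidef}

/-! ### The actions of the symmetric group and of the orthogonal group -/

/-- The representation of the symmetric group on `ℝ^n` by permuting coordinates; it sends the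
`i`-th unit vector to the `σ i`-th one. -/
def permRep (n : ℕ) : Representation ℝ (Equiv.Perm (Fin n)) (Fin n → ℝ) where
  toFun σ := LinearMap.funLeft ℝ ℝ (σ⁻¹ : Equiv.Perm (Fin n))
  map_one' := by ext; simp [LinearMap.funLeft]
  map_mul' σ τ := by ext; simp [LinearMap.funLeft, Function.comp_def]

/-- The embedding of the symmetric group into `O(n)` by permutation matrices; the matrix of `σ`
sends the `i`-th unit vector to the `σ i`-th one. -/
def permToOrthogonal (n : ℕ) : Equiv.Perm (Fin n) →* Matrix.orthogonalGroup (Fin n) ℝ where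
  toFun σ := ⟨(σ⁻¹).permMatrix ℝ, by
    rw [Matrix.mem_orthogonalGroup_iff, Matrix.transpose_permMatrix, ← Matrix.permMatrix_mul]
    simp⟩
  map_one' := by
    apply Subtype.ext
    simp
  map_mul' σ τ := by
    apply Subtype.ext
    simp [Matrix.permMatrix_mul]

/-- The representation of `O(n)` on symmetric matrices: `U` sends `X` to `U X Uᵀ`. -/
def conjRep (n : ℕ) : Representation ℝ (Matrix.orthogonalGroup (Fin n) ℝ) (SymMat n) where
  toFun U :=
    { toFun := fun X => ⟨U.1 * X.1 * U.1.transpose, by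
        have hX : X.1.transpose = X.1 := X.2
        change (U.1 * X.1 * U.1.transpose).transpose = _
        rw [Matrix.transpose_mul, Matrix.transpose_mul, Matrix.transpose_transpose, hX,
          Matrix.mul_assoc]⟩
      map_add' := fun X Y => by
        apply Subtype.ext
        simp [Matrix.mul_add, Matrix.add_mul]
      map_smul' := fun c X => by
        apply Subtype.ext
        simp }
  map_one' := by
    ext X : 2
    simp
  map_mul' U U' := by
    ext X : 2
    simp [Matrix.mul_assoc]

/-- A representation on a real vector space of a topological group is continuous if all its matrix
coefficients are continuous; for finite-dimensional spaces this is the usual continuity. -/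
def IsContinuousRep {G W : Type*} [Group G] [TopologicalSpace G] [AddCommGroup W] [Module ℝ W]
    (ρ : Representation ℝ G W) : Prop :=
  ∀ (w : W) (f : Module.Dual ℝ W), Continuous fun g => f (ρ g w)

end SpectralLMI

open SpectralLMI

/-! Put k = n / 2. A two-row Specht module maps nontrivially to the functions on k-subsets of the
labels (`Tableau.exists_hom_spechtRep`), so a short representation V is an equivariant direct
summand of m copies of this permutation module (`IsShort.exists_embedding`). In these coordinates φ
is an m × m array of equivariant kernels κ(a; I, J) on pairs of k-subsets, linear in a.

For W take m copies of T ⊗ T with T = (ℝ^n)^{⊗ k}; only the part alternating in each factor matters.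
The entries f(I, J) of such a tensor are grouped by A = I \ J and B = J \ I, which form a `Block`.
Inside a block what remains is a function C ↦ f(C ∪ A, C ∪ B). After a matching π of A with B is
chosen, `Block.comp` spreads it, up to signs of orderings, over the k-subsets through the products
e_C ∏_{p ∈ A} (e_p - e_{π p}). The empty block just gives the diagonal C ↦ f(C, C).

The point is that natural O(n)-equivariant operations on tensors become, in every block, the same
operation on functions of sets: the contraction becomes summation over one added element
(`Block.sumCons_comp`), the inner product becomes the inner product with weight 2^{-|A|}
(`tensorInner_eq_sum_block`), and the symmetrized derivation by diag(a), inserted in an invariant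
form, becomes multiplication by the sum of a over the set (`IsInvariantLift.mulSum_swap`). Together
with the trace these operations generate all equivariant kernels on sets (`IsSetKernel.liftable`).

Hence φ lifts to an equivariant Φ such that the form Φ(diag a) is a sum over blocks of pullbacks of
φ(a) with positive weights (`exists_form`). So φ(a) ⪰ 0 implies Φ(diag a) ⪰ 0. The map P keeps only
the empty block, so it sends Φ(diag a) to φ(a), which gives the converse. Orthogonal diagonalization
reduces every X to a diagonal matrix, and the spectrahedral description follows by writing Φ in a
basis. -/

namespace SpectralLMI

/-! ### Two-row Specht modules and functions on subsets -/

/-- The action of the symmetric group on functions of `k`-tuples. -/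
def tupRep (n k : ℕ) : Representation ℝ (Equiv.Perm (Fin n)) ((Fin k → Fin n) → ℝ) where
  toFun σ := LinearMap.funLeft ℝ ℝ fun i r => σ⁻¹ (i r)
  map_one' := by ext; simp [LinearMap.funLeft]
  map_mul' σ τ := by ext; simp [LinearMap.funLeft, Function.comp_def]

theorem tupRep_apply {n k : ℕ} (σ : Equiv.Perm (Fin n)) (v : (Fin k → Fin n) → ℝ)
    (i : Fin k → Fin n) : tupRep n k σ v i = v (⇑σ⁻¹ ∘ i) := rfl

/-- Functions of `k`-element sets, viewed as symmetric functions of `k`-tuples that vanish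
on tuples with a repetition. -/
def setFun (n k : ℕ) : Submodule ℝ ((Fin k → Fin n) → ℝ) where
  carrier := {v | (∀ (σ : Equiv.Perm (Fin k)) i, v (i ∘ σ) = v i) ∧
    ∀ i, ¬ Function.Injective i → v i = 0}
  add_mem' {v w} hv hw := ⟨fun σ i => by simp [hv.1, hw.1], fun i hi => by simp [hv.2 i hi, hw.2 i hi]⟩
  zero_mem' := ⟨fun _ _ => rfl, fun _ _ => rfl⟩
  smul_mem' c v hv := ⟨fun σ i => by simp [hv.1], fun i hi => by simp [hv.2 i hi]⟩

theorem tupRep_mem_setFun {n k : ℕ} (σ : Equiv.Perm (Fin n)) {v : (Fin k → Fin n) → ℝ}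
    (hv : v ∈ setFun n k) : tupRep n k σ v ∈ setFun n k := by
  refine ⟨fun τ i => ?_, fun i hi => ?_⟩
  · rw [tupRep_apply, tupRep_apply, ← Function.comp_assoc, hv.1 τ]
  · refine hv.2 _ fun h => hi ?_
    exact h.of_comp

theorem asAlgebraHom_mem_setFun {n k : ℕ} (x : MonoidAlgebra ℝ (Equiv.Perm (Fin n)))
    {v : (Fin k → Fin n) → ℝ} (hv : v ∈ setFun n k) :
    (tupRep n k).asAlgebraHom x v ∈ setFun n k := by
  induction x using MonoidAlgebra.induction_linear with
  | zero => simp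
  | add x y hx hy => simpa using add_mem hx hy
  | single g r =>
    rw [Representation.asAlgebraHom_single]
    exact Submodule.smul_mem _ _ (tupRep_mem_setFun g hv)

/-- The indicator function of the set of enumerations of `S`. -/
noncomputable def enumIndicator {n : ℕ} (k : ℕ) (S : Finset (Fin n)) : (Fin k → Fin n) → ℝ :=
  fun i => if Function.Injective i ∧ Finset.univ.image i = S then 1 else 0

theorem image_comp_perm {α : Type*} [DecidableEq α] {k : ℕ} (i : Fin k → α)
    (σ : Equiv.Perm (Fin k)) : Finset.univ.image (i ∘ σ) = Finset.univ.image i := by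
  ext x
  simp only [Finset.mem_image, Finset.mem_univ, true_and, Function.comp_apply]
  exact ⟨fun ⟨a, h⟩ => ⟨_, h⟩, fun ⟨a, h⟩ => ⟨σ.symm a, by simpa using h⟩⟩

theorem enumIndicator_mem_setFun {n k : ℕ} (S : Finset (Fin n)) :
    enumIndicator k S ∈ setFun n k := by
  refine ⟨fun σ i => ?_, fun i hi => ?_⟩
  · simp [enumIndicator, image_comp_perm, σ.injective_comp i]
  · simp [enumIndicator, hi]

namespace Tableau
variable {n : ℕ} {p : n.Partition} (T : Tableau p)

theorem mem_iff_lt {n : ℕ} {p : n.Partition} {c : ℕ × ℕ} : c ∈ youngDiagram p ↔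
    ∃ h : c.1 < p.parts.card, c.2 < (p.parts.sort (· ≥ ·))[c.1]'(by simpa using h) := by
  simp [youngDiagram, YoungDiagram.mem_ofRowLens]

theorem ext_row_col {i j : Fin n} (h₁ : T.row i = T.row j) (h₂ : T.col i = T.col j) : i = j := by
  apply T.symm.injective
  exact Subtype.ext (Prod.ext h₁ h₂)

theorem row_lt (i : Fin n) : T.row i < p.parts.card := by
  have := (T.symm i).2
  rw [YoungDiagram.mem_cells, mem_iff_lt] at this
  exact this.1

theorem exists_row_zero (i : Fin n) : ∃ j, T.row j = 0 ∧ T.col j = T.col i := by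
  have h := (T.symm i).2
  rw [YoungDiagram.mem_cells] at h
  have h0 : ((0, T.col i) : ℕ × ℕ) ∈ (youngDiagram p).cells := by
    rw [YoungDiagram.mem_cells]
    exact (youngDiagram p).up_left_mem (Nat.zero_le _) le_rfl h
  exact ⟨T ⟨_, h0⟩, by simp [row], by simp [col]⟩

/-- A two-row tableau has a set of `n / 2` labels that contains the second row and no label above
the second row. -/
theorem exists_half_set (hp : p.parts.card ≤ 2) : ∃ S : Finset (Fin n), S.card = n / 2 ∧
    (∀ i, T.row i = 1 → i ∈ S) ∧
    ∀ i ∈ S, T.row i = 0 → ∀ j, T.row j = 1 → T.col j ≠ T.col i := by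
  classical
  have hrow : ∀ i, T.row i = 0 ∨ T.row i = 1 := fun i => by have := T.row_lt i; omega
  let R : Finset (Fin n) := {i | T.row i = 1}
  let X : Finset (Fin n) := {i | T.row i = 0 ∧ ∀ j, T.row j = 1 → T.col j ≠ T.col i}
  let Y : Finset (Fin n) := {i | T.row i = 0 ∧ ∃ j, T.row j = 1 ∧ T.col j = T.col i}
  have hRX : Disjoint R X := by
    rw [Finset.disjoint_left]; intro i hi hi'
    simp only [R, X, Finset.mem_filter, Finset.mem_univ, true_and] at hi hi'
    omega
  have hRXY : Disjoint (R ∪ X) Y := by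
    rw [Finset.disjoint_left]; intro i hi hi'
    simp only [R, X, Y, Finset.mem_union, Finset.mem_filter, Finset.mem_univ, true_and] at hi hi'
    obtain ⟨h0, j, hj, hj'⟩ := hi'
    rcases hi with hi | hi
    · omega
    · exact hi.2 j hj hj'
  have hu : (R ∪ X) ∪ Y = Finset.univ := by
    ext i
    simp only [R, X, Y, Finset.mem_union, Finset.mem_filter, Finset.mem_univ, true_and, iff_true]
    rcases hrow i with h | h
    · by_cases hx : ∃ j, T.row j = 1 ∧ T.col j = T.col i
      · exact Or.inr ⟨h, hx⟩
      · push Not at hx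
        exact Or.inl (Or.inr ⟨h, hx⟩)
    · exact Or.inl (Or.inl h)
  have hRY : R.card = Y.card := by
    choose u hu0 hu1 using T.exists_row_zero
    have hYi : Y = R.image u := by
      ext i
      simp only [R, Y, Finset.mem_filter, Finset.mem_univ, true_and, Finset.mem_image]
      constructor
      · rintro ⟨h, j, hj, hj'⟩
        exact ⟨j, hj, T.ext_row_col ((hu0 j).trans h.symm) ((hu1 j).trans hj')⟩
      · rintro ⟨j, hj, rfl⟩
        exact ⟨hu0 j, j, hj, (hu1 j).symm⟩
    rw [hYi, Finset.card_image_of_injOn]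
    intro i hi j hj hij
    simp only [R, Finset.coe_filter, Finset.mem_univ, true_and, Set.mem_ofPred_eq] at hi hj
    exact T.ext_row_col (hi.trans hj.symm) (by rw [← hu1 i, ← hu1 j, hij])
  have hc : R.card + X.card + Y.card = n := by
    rw [← Finset.card_union_of_disjoint hRX, ← Finset.card_union_of_disjoint hRXY, hu]; simp
  -- Since |R| = |Y| and |R| + |X| + |Y| = n, the number n / 2 lies between |R| and |R| + |X|. This
  -- is why the single size n / 2 serves all two-row shapes.
  obtain ⟨S, hRS, hSX, hS⟩ := Finset.exists_subsuperset_card_eq (n := n / 2)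
    (Finset.subset_union_left (s₁ := R) (s₂ := X)) (by omega)
    (by rw [Finset.card_union_of_disjoint hRX]; omega)
  refine ⟨S, hS, fun i hi => hRS (by simpa [R] using hi), fun i hi h0 j hj => ?_⟩
  have := hSX hi
  simp only [R, X, Finset.mem_union, Finset.mem_filter, Finset.mem_univ, true_and] at this
  rcases this with h | h
  · omega
  · exact h.2 j hj

/-- The only column permutation that maps a set as in `exists_half_set` to a set containing the
second row is the identity. -/
theorem eq_one_of_col (hp : p.parts.card ≤ 2) {S : Finset (Fin n)}
    (hS : ∀ i ∈ S, T.row i = 0 → ∀ j, T.row j = 1 → T.col j ≠ T.col i)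
    (c : Equiv.Perm (Fin n)) (hc : ∀ i, T.col (c i) = T.col i)
    (h : ∀ j, T.row j = 1 → c⁻¹ j ∈ S) : c = 1 := by
  have hrow : ∀ i, T.row i = 0 ∨ T.row i = 1 := fun i => by have := T.row_lt i; omega
  have hc' : ∀ i, T.col (c⁻¹ i) = T.col i := fun i => by rw [← hc]; simp
  have h1 : ∀ j, T.row j = 1 → c⁻¹ j = j := by
    intro j hj
    refine T.ext_row_col ?_ (hc' j)
    rcases hrow (c⁻¹ j) with h0 | h0
    · exact absurd (hc' j).symm (hS _ (h j hj) h0 j hj)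
    · rw [h0, hj]
  have h2 : ∀ j, c⁻¹ j = j := by
    intro j
    rcases hrow j with h0 | h0
    · rcases hrow (c⁻¹ j) with h3 | h3
      · exact T.ext_row_col (h3.trans h0.symm) (hc' j)
      · exact c⁻¹.injective (h1 _ h3)
    · exact h1 j h0
  rw [← inv_inj, inv_one]
  exact Equiv.ext h2

/-- Evaluate at an enumeration of S. A term r * c contributes only if r * c maps S to itself. As r
preserves the second row, which lies in S, this puts the preimage under c of the second row into S
and forces c = 1. No sign is left, so the value is a sum of nonnegative terms in which r = 1
contributes 1. -/
theorem asAlgebraHom_youngSymmetrizer_ne_zero (hp : p.parts.card ≤ 2) {S : Finset (Fin n)}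
    {k : ℕ} (hk : S.card = k) (hR : ∀ i, T.row i = 1 → i ∈ S)
    (hS : ∀ i ∈ S, T.row i = 0 → ∀ j, T.row j = 1 → T.col j ≠ T.col i) :
    (tupRep n k).asAlgebraHom T.youngSymmetrizer (enumIndicator k S) ≠ 0 := by
  classical
  intro h0
  let i₀ : Fin k → Fin n := S.orderEmbOfFin hk
  have hi₀ : Function.Injective i₀ := (S.orderEmbOfFin hk).injective
  have him : Finset.univ.image i₀ = S := by
    apply Finset.coe_injective
    simp [i₀]
  have him' : ∀ g : Equiv.Perm (Fin n), Finset.univ.image (g ∘ i₀) = S.image g := fun g => by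
    rw [← him, Finset.image_image]
  have key : ∀ r c : Equiv.Perm (Fin n), (∀ i, T.row (r i) = T.row i) →
      (∀ i, T.col (c i) = T.col i) →
      ((Equiv.Perm.sign c : ℤ) : ℝ) * tupRep n k (r * c) (enumIndicator k S) i₀ =
        if c = 1 then tupRep n k r (enumIndicator k S) i₀ else 0 := by
    intro r c hr hc
    split_ifs with h1
    · simp [h1]
    rw [mul_eq_zero]
    right
    rw [tupRep_apply, enumIndicator, if_neg]
    rintro ⟨-, h2⟩
    rw [him'] at h2
    apply h1
    refine T.eq_one_of_col hp hS c hc fun j hj => ?_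
    rw [← h2]
    have h3 : T.row (r j) = 1 := by rw [hr, hj]
    exact Finset.mem_image.2 ⟨r j, hR _ h3, by simp⟩
  have hsum : (tupRep n k).asAlgebraHom T.youngSymmetrizer (enumIndicator k S) i₀ =
      ∑ r : Equiv.Perm (Fin n) with ∀ i, T.row (r i) = T.row i,
        tupRep n k r (enumIndicator k S) i₀ := by
    rw [youngSymmetrizer, rowSum, colSum, Finset.sum_mul_sum]
    simp only [map_sum, LinearMap.sum_apply, Finset.sum_apply]
    refine Finset.sum_congr rfl fun r hr => ?_
    rw [← Finset.sum_subset (s₁ := {1})]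
    · simp [Representation.asAlgebraHom_single]
    · simp
    · intro c hc hc1
      simp only [Finset.mem_filter, Finset.mem_univ, true_and] at hr hc
      have := key r c hr hc
      rw [if_neg (by simpa using hc1)] at this
      rw [← this, mul_smul_comm, map_smul, ← map_mul, Representation.asAlgebraHom_of]
      rfl
  have hpos : 0 < ∑ r : Equiv.Perm (Fin n) with ∀ i, T.row (r i) = T.row i,
        tupRep n k r (enumIndicator k S) i₀ := by
    refine Finset.sum_pos' (fun r _ => ?_) ⟨1, by simp, ?_⟩
    · rw [tupRep_apply, enumIndicator]
      split_ifs <;> norm_num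
    · simp [enumIndicator, him, hi₀]
  rw [← hsum, h0] at hpos
  simp at hpos

theorem spechtRep_coe (g : Equiv.Perm (Fin n))
    (x : (Ideal.span {T.youngSymmetrizer} : Ideal (MonoidAlgebra ℝ (Equiv.Perm (Fin n))))) :
    (T.spechtRep g x : MonoidAlgebra ℝ (Equiv.Perm (Fin n))) =
      MonoidAlgebra.single g 1 * x.1 := rfl

/-- The map lets an element of the left ideal act on the indicator of the set S from
`exists_half_set`; it does not vanish at the Young symmetrizer. -/
theorem exists_hom_spechtRep (hp : p.parts.card ≤ 2) :
    ∃ ψ : T.spechtRep.IntertwiningMap (tupRep n (n / 2)),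
      (∀ x, ψ x ∈ setFun n (n / 2)) ∧ ∃ x, ψ x ≠ 0 := by
  obtain ⟨S, hk, hR, hS⟩ := T.exists_half_set hp
  let ψ : (Ideal.span {T.youngSymmetrizer} : Ideal (MonoidAlgebra ℝ (Equiv.Perm (Fin n))))
      →ₗ[ℝ] ((Fin (n / 2) → Fin n) → ℝ) :=
    { toFun := fun x => (tupRep n (n / 2)).asAlgebraHom x.1 (enumIndicator (n / 2) S)
      map_add' := fun x y => by simp
      map_smul' := fun c x => by simp }
  have hψ : ∀ g x, ψ (T.spechtRep g x) = tupRep n (n / 2) g (ψ x) := by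
    intro g x
    change (tupRep n (n / 2)).asAlgebraHom (T.spechtRep g x).1 _ = _
    rw [spechtRep_coe, map_mul, Representation.asAlgebraHom_single, one_smul]
    rfl
  refine ⟨⟨ψ, fun g => LinearMap.ext (hψ g)⟩, fun x => ?_,
    ⟨_, Ideal.mem_span_singleton_self _⟩, ?_⟩
  · exact asAlgebraHom_mem_setFun x.1 (enumIndicator_mem_setFun S)
  · exact T.asAlgebraHom_youngSymmetrizer_ne_zero hp hk hR hS

end Tableau
end SpectralLMI

/-! ### Averaging, and the embedding of a short representation -/

namespace SpectralLMI

section Average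
variable {G V E : Type*} [Group G] [Fintype G] [AddCommGroup V] [Module ℝ V] [AddCommGroup E]
  [Module ℝ E] (ρ : Representation ℝ G V) (τ : Representation ℝ G E)

/-- The equivariant average of a linear map between representations of a finite group. -/
noncomputable def equivariantAverage (f : V →ₗ[ℝ] E) : V →ₗ[ℝ] E :=
  (Fintype.card G : ℝ)⁻¹ • ∑ g : G, τ g ∘ₗ f ∘ₗ ρ g⁻¹

theorem equivariantAverage_apply (f : V →ₗ[ℝ] E) (v : V) : equivariantAverage ρ τ f v =
    (Fintype.card G : ℝ)⁻¹ • ∑ g : G, τ g (f (ρ g⁻¹ v)) := by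
  simp [equivariantAverage]

theorem equivariantAverage_comm (f : V →ₗ[ℝ] E) (g : G) (v : V) :
    equivariantAverage ρ τ f (ρ g v) = τ g (equivariantAverage ρ τ f v) := by
  rw [equivariantAverage_apply, equivariantAverage_apply, map_smul, map_sum,
    ← Equiv.sum_comp (Equiv.mulLeft g)]
  congr 1
  refine Finset.sum_congr rfl fun h _ => ?_
  simp only [Equiv.coe_mulLeft, mul_inv_rev, map_mul, Module.End.mul_apply]
  simp

theorem equivariantAverage_eq (f : V →ₗ[ℝ] E) (v : V) (hv : ∀ g, τ g (f (ρ g⁻¹ v)) = f v) :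
    equivariantAverage ρ τ f v = f v := by
  rw [equivariantAverage_apply]
  simp only [hv, Finset.sum_const, Finset.card_univ]
  rw [← Nat.cast_smul_eq_nsmul ℝ, smul_smul, inv_mul_cancel₀, one_smul]
  exact_mod_cast Fintype.card_ne_zero

theorem equivariantAverage_mem (f : V →ₗ[ℝ] E) (N : Submodule ℝ E) (hf : ∀ v, f v ∈ N)
    (hN : ∀ g, ∀ x ∈ N, τ g x ∈ N) (v : V) : equivariantAverage ρ τ f v ∈ N := by
  rw [equivariantAverage_apply]
  exact N.smul_mem _ (N.sum_mem fun g _ => hN g _ (hf _))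

end Average

/-- A nonzero finite-dimensional representation contains an irreducible one. -/
theorem exists_irreducible_le {G V : Type*} [Group G] [AddCommGroup V] [Module ℝ V]
    [FiniteDimensional ℝ V] {ρ : Representation ℝ G V} (K : Subrepresentation ρ)
    (hK : K.toSubmodule ≠ ⊥) :
    ∃ U : Subrepresentation ρ, U.toSubmodule ≤ K.toSubmodule ∧
      U.toRepresentation.IsIrreducible := by
  -- A nonzero subrepresentation of least dimension is irreducible.
  let P : ℕ → Prop := fun d => ∃ U : Subrepresentation ρ, U.toSubmodule ≤ K.toSubmodule ∧
    U.toSubmodule ≠ ⊥ ∧ Module.finrank ℝ U.toSubmodule = d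
  have hP : ∃ d, P d := ⟨_, K, le_rfl, hK, rfl⟩
  classical
  obtain ⟨U, hUK, hU, hd⟩ := Nat.find_spec hP
  refine ⟨U, hUK, ?_⟩
  have hnt : Nontrivial (Subrepresentation U.toRepresentation) := by
    refine ⟨⊥, ⊤, fun h => hU ?_⟩
    have h1 : (⊥ : Submodule ℝ U.toSubmodule) = ⊤ :=
      congrArg Subrepresentation.toSubmodule h
    rw [Submodule.eq_bot_iff]
    intro x hx
    have : (⟨x, hx⟩ : U.toSubmodule) ∈ (⊥ : Submodule ℝ U.toSubmodule) := h1 ▸ Submodule.mem_top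
    simpa using this
  refine { toNontrivial := hnt, eq_bot_or_eq_top := fun N => ?_ }
  by_contra! hN
  let N' : Subrepresentation ρ :=
    { toSubmodule := N.toSubmodule.map U.toSubmodule.subtype
      apply_mem_toSubmodule := by
        rintro g _ ⟨x, hx, rfl⟩
        exact ⟨U.toRepresentation g x, N.apply_mem_toSubmodule g hx, rfl⟩ }
  have hNU : N'.toSubmodule ≤ U.toSubmodule := Submodule.map_subtype_le _ _
  have hlt : N'.toSubmodule < U.toSubmodule := by
    refine lt_of_le_of_ne hNU fun h => hN.2 ?_
    apply Subrepresentation.toSubmodule_injective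
    change N.toSubmodule = ⊤
    rw [eq_top_iff]
    rintro ⟨x, hx⟩ -
    obtain ⟨y, hy, hyx⟩ := h.symm ▸ hx
    have : y = ⟨x, hx⟩ := Subtype.ext hyx
    exact this ▸ hy
  refine Nat.find_min hP (m := Module.finrank ℝ N'.toSubmodule) ?_
    ⟨N', hNU.trans hUK, fun h => hN.1 ?_, rfl⟩
  · rw [← hd]
    exact Submodule.finrank_lt_finrank_of_lt hlt
  · apply Subrepresentation.toSubmodule_injective
    change N.toSubmodule = ⊥
    rw [Submodule.eq_bot_iff]
    intro x hx
    have : (x : V) ∈ N'.toSubmodule := ⟨x, hx, rfl⟩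
    rw [h] at this
    exact Subtype.ext (by simpa using this)

section Short
variable {n : ℕ} {V : Type*} [AddCommGroup V] [Module ℝ V]

/-- The space of equivariant maps from a representation to the functions of `k`-element sets. -/
def homSetFun (k : ℕ) (ρ : Representation ℝ (Equiv.Perm (Fin n)) V) :
    Submodule ℝ (V →ₗ[ℝ] ((Fin k → Fin n) → ℝ)) where
  carrier := {f | (∀ g v, f (ρ g v) = tupRep n k g (f v)) ∧ ∀ v, f v ∈ setFun n k}
  add_mem' {f f'} hf hf' := ⟨fun g v => by simp [hf.1, hf'.1],
    fun v => add_mem (hf.2 v) (hf'.2 v)⟩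
  zero_mem' := ⟨fun g v => by simp, fun v => zero_mem _⟩
  smul_mem' c f hf := ⟨fun g v => by simp [hf.1], fun v => Submodule.smul_mem _ c (hf.2 v)⟩

variable [FiniteDimensional ℝ V] {ρ : Representation ℝ (Equiv.Perm (Fin n)) V}

/-- The common kernel of all equivariant maps to functions on sets is a subrepresentation. Were it
nonzero, it would contain an irreducible U, and a nonzero equivariant map on U extends to the whole
of V, contradicting the choice of U. -/
theorem IsShort.eq_zero_of_homSetFun (hρ : IsShort ρ) (v : V)
    (hv : ∀ f ∈ homSetFun (n / 2) ρ, f v = 0) : v = 0 := by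
  let K : Subrepresentation ρ :=
    { toSubmodule := ⨅ f : homSetFun (n / 2) ρ, LinearMap.ker f.1
      apply_mem_toSubmodule := by
        intro g v hv
        simp only [Submodule.mem_iInf, LinearMap.mem_ker] at hv ⊢
        intro f
        rw [f.2.1, hv f, map_zero] }
  have hvK : v ∈ K.toSubmodule := by
    simp only [K, Submodule.mem_iInf, LinearMap.mem_ker]
    exact fun f => hv f.1 f.2
  by_contra hv0
  obtain ⟨U, hUK, hU⟩ := exists_irreducible_le K fun h => hv0 (by simpa [h] using hvK)
  obtain ⟨p, hp, T, ⟨e⟩⟩ := hρ U hU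
  obtain ⟨ψ, hψ, x, hx⟩ := T.exists_hom_spechtRep hp
  obtain ⟨q, hq⟩ := U.toSubmodule.exists_isCompl
  -- Extend by a linear projection onto U, then average over the group. The average does not change
  -- the values on U, where the map is already equivariant.
  let f₀ : V →ₗ[ℝ] ((Fin (n / 2) → Fin n) → ℝ) :=
    ψ.toLinearMap ∘ₗ e.toIntertwiningMap.toLinearMap ∘ₗ U.toSubmodule.projectionOnto q hq
  have hf₀ : ∀ u : U.toSubmodule, f₀ u = ψ (e u) := by
    intro u
    change ψ (e (U.toSubmodule.projectionOnto q hq u)) = _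
    simp
  let f := equivariantAverage ρ (tupRep n (n / 2)) f₀
  have hf : f ∈ homSetFun (n / 2) ρ :=
    ⟨equivariantAverage_comm _ _ _, equivariantAverage_mem _ _ _ _ (fun _ => hψ _)
      fun g _ h => tupRep_mem_setFun g h⟩
  have hfu : ∀ u : U.toSubmodule, f u = ψ (e u) := by
    intro u
    rw [← hf₀]
    refine equivariantAverage_eq _ _ _ _ fun g => ?_
    have h1 : ρ g⁻¹ u = (U.toRepresentation g⁻¹ u : U.toSubmodule) := rfl
    have h2 : ψ (e (U.toRepresentation g⁻¹ u)) = tupRep n (n / 2) g⁻¹ (ψ (e u)) := by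
      rw [← ψ.isIntertwining]
      exact congrArg ψ (Representation.IntertwiningMap.isIntertwining _ _ e.toIntertwiningMap g⁻¹ u)
    rw [h1, hf₀, hf₀, h2, ← Module.End.mul_apply, ← map_mul]
    simp
  have hmem := hUK (e.symm x).2
  simp only [K, Submodule.mem_iInf, LinearMap.mem_ker] at hmem
  have := hmem ⟨f, hf⟩
  apply hx
  rw [← this]
  change _ = f _
  rw [hfu]
  congr 1
  exact (e.toLinearEquiv.apply_symm_apply x).symm

/-- The components ι are a basis of the equivariant maps; they separate points by
`IsShort.eq_zero_of_homSetFun`. A linear left inverse becomes equivariant by averaging and remains a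
left inverse because ι is equivariant. -/
theorem IsShort.exists_embedding (hρ : IsShort ρ) :
    ∃ (m : ℕ) (ι : Fin m → V →ₗ[ℝ] ((Fin (n / 2) → Fin n) → ℝ)),
      (∀ s, ι s ∈ homSetFun (n / 2) ρ) ∧
      ∃ r : (Fin m → (Fin (n / 2) → Fin n) → ℝ) →ₗ[ℝ] V,
        (∀ g x, r (fun s => tupRep n (n / 2) g (x s)) = ρ g (r x)) ∧
        ∀ v, r (fun s => ι s v) = v := by
  have : Module.Free ℝ (homSetFun (n / 2) ρ) :=
    @Module.Free.of_divisionRing ℝ (homSetFun (n / 2) ρ) _ (homSetFun (n / 2) ρ).addCommGroup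
      (homSetFun (n / 2) ρ).module
  have : Module.Finite ℝ (homSetFun (n / 2) ρ) :=
    FiniteDimensional.finiteDimensional_submodule _
  let b := Module.finBasis ℝ (homSetFun (n / 2) ρ)
  let ι : Fin (Module.finrank ℝ (homSetFun (n / 2) ρ)) → V →ₗ[ℝ] ((Fin (n / 2) → Fin n) → ℝ) :=
    fun s => (b s).1
  have hι : ∀ s, ι s ∈ homSetFun (n / 2) ρ := fun s => (b s).2
  let J := LinearMap.pi ι
  have hJ : LinearMap.ker J = ⊥ := by
    rw [LinearMap.ker_eq_bot']
    intro v hv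
    refine hρ.eq_zero_of_homSetFun v fun f hf => ?_
    have h1 := b.sum_repr ⟨f, hf⟩
    have h2 : f = ∑ s, b.repr ⟨f, hf⟩ s • ι s := by
      have h3 := congrArg (homSetFun (n / 2) ρ).subtype h1
      rw [map_sum] at h3
      exact h3.symm
    rw [h2]
    simp only [LinearMap.sum_apply, LinearMap.smul_apply]
    refine Finset.sum_eq_zero fun s _ => ?_
    have : ι s v = 0 := congrFun hv s
    rw [this, smul_zero]
  obtain ⟨r₀, hr₀⟩ := J.exists_leftInverse_of_injective hJ
  let τ : Representation ℝ (Equiv.Perm (Fin n))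
      (Fin (Module.finrank ℝ (homSetFun (n / 2) ρ)) → (Fin (n / 2) → Fin n) → ℝ) :=
    { toFun := fun g => LinearMap.pi fun s => tupRep n (n / 2) g ∘ₗ LinearMap.proj s
      map_one' := by ext; simp
      map_mul' := fun g h => by ext; simp }
  refine ⟨_, ι, hι, equivariantAverage τ ρ r₀, fun g x => equivariantAverage_comm τ ρ r₀ g x,
    fun v => ?_⟩
  have hrJ : ∀ v, r₀ (J v) = v := fun v => LinearMap.congr_fun hr₀ v
  have hJτ : ∀ g v, τ g (J v) = J (ρ g v) := by
    intro g v
    funext s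
    exact ((hι s).1 g v).symm
  refine (equivariantAverage_eq τ ρ r₀ (J v) fun g => ?_).trans (hrJ v)
  rw [hJτ, hrJ, hrJ, ← Module.End.mul_apply, ← map_mul]
  simp

end Short
end SpectralLMI

/-! ### Equivariant operations on tensors: derivation, contraction, inner product -/

namespace SpectralLMI

/-- Operators on `(ℝ^n)^{⊗ k}`, which are also the elements of `(ℝ^n)^{⊗ k} ⊗ (ℝ^n)^{⊗ k}`. -/
abbrev TensorMat (n k : ℕ) : Type := Matrix (Fin k → Fin n) (Fin k → Fin n) ℝ

section Tensor
variable {n k : ℕ}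

/-- The tensor product of `k` operators on `ℝ^n`. -/
def tensorProd (A : Fin k → Matrix (Fin n) (Fin n) ℝ) : TensorMat n k :=
  Matrix.of fun i j => ∏ r, A r (i r) (j r)

theorem tensorProd_apply (A : Fin k → Matrix (Fin n) (Fin n) ℝ) (i j : Fin k → Fin n) :
    tensorProd A i j = ∏ r, A r (i r) (j r) := rfl

theorem tensorProd_mul (A B : Fin k → Matrix (Fin n) (Fin n) ℝ) :
    tensorProd A * tensorProd B = tensorProd fun r => A r * B r := by
  ext i j
  simp only [Matrix.mul_apply, tensorProd_apply, Finset.prod_univ_sum, Fintype.piFinset_univ,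
    Finset.prod_mul_distrib]

theorem tensorProd_one : tensorProd (fun _ : Fin k => (1 : Matrix (Fin n) (Fin n) ℝ)) = 1 := by
  ext i j
  rw [tensorProd_apply, Matrix.one_apply]
  split_ifs with h
  · subst h
    exact Finset.prod_eq_one fun r _ => Matrix.one_apply_eq _
  · obtain ⟨r, hr⟩ := Function.ne_iff.1 h
    exact Finset.prod_eq_zero (Finset.mem_univ r) (Matrix.one_apply_ne hr)

/-- The `k`-th tensor power of an operator. -/
def tensorPow (k : ℕ) (U : Matrix (Fin n) (Fin n) ℝ) : TensorMat n k := tensorProd fun _ => U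

theorem tensorPow_apply (U : Matrix (Fin n) (Fin n) ℝ) (i j : Fin k → Fin n) :
    tensorPow k U i j = ∏ r, U (i r) (j r) := rfl

theorem tensorPow_mul (U U' : Matrix (Fin n) (Fin n) ℝ) :
    tensorPow k (U * U') = tensorPow k U * tensorPow k U' := (tensorProd_mul _ _).symm

theorem tensorPow_one : tensorPow k (1 : Matrix (Fin n) (Fin n) ℝ) = 1 := tensorProd_one

theorem tensorPow_transpose (U : Matrix (Fin n) (Fin n) ℝ) :
    (tensorPow k U).transpose = tensorPow k U.transpose := rfl

theorem tensorPow_transpose_mul {U : Matrix (Fin n) (Fin n) ℝ} (hU : U.transpose * U = 1) :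
    (tensorPow k U).transpose * tensorPow k U = 1 := by
  rw [tensorPow_transpose, ← tensorPow_mul, hU, tensorPow_one]

theorem tensorPow_cons (U : Matrix (Fin n) (Fin n) ℝ) (a b : Fin n) (i j : Fin k → Fin n) :
    tensorPow (k + 1) U (Fin.cons a i : Fin (k + 1) → Fin n) (Fin.cons b j : Fin (k + 1) → Fin n) =
      U a b * tensorPow k U i j := by
  simp [tensorPow_apply, Fin.prod_univ_succ]

/-- The derivation of `(ℝ^n)^{⊗ k}` induced by an operator on `ℝ^n`. -/
def tensorDeriv (k : ℕ) : Matrix (Fin n) (Fin n) ℝ →ₗ[ℝ] TensorMat n k where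
  toFun X := ∑ r, tensorProd (Function.update (fun _ => 1) r X)
  map_add' X Y := by
    rw [← Finset.sum_add_distrib]
    refine Finset.sum_congr rfl fun r _ => ?_
    ext i j
    simp only [tensorProd_apply, Matrix.add_apply, ← Finset.mul_prod_erase _ _ (Finset.mem_univ r),
      Function.update_self, add_mul]
    congr 2 <;>
    · refine Finset.prod_congr rfl fun s hs => ?_
      simp [Function.update_of_ne (Finset.ne_of_mem_erase hs)]
  map_smul' c X := by
    rw [RingHom.id_apply, Finset.smul_sum]
    refine Finset.sum_congr rfl fun r _ => ?_
    ext i j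
    simp only [tensorProd_apply, Matrix.smul_apply,
      ← Finset.mul_prod_erase _ _ (Finset.mem_univ r), Function.update_self, smul_eq_mul, mul_assoc]
    congr 2
    refine Finset.prod_congr rfl fun s hs => ?_
    simp [Function.update_of_ne (Finset.ne_of_mem_erase hs)]

theorem tensorDeriv_apply (X : Matrix (Fin n) (Fin n) ℝ) :
    tensorDeriv k X = ∑ r, tensorProd (Function.update (fun _ => 1) r X) := rfl

/-- Compare factor by factor: in the distinguished slot X is conjugated, and in the others `U * 1 *
Uᵀ = 1`. -/
theorem tensorDeriv_conj {U : Matrix (Fin n) (Fin n) ℝ} (hU : U * U.transpose = 1)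
    (X : Matrix (Fin n) (Fin n) ℝ) : tensorDeriv k (U * X * U.transpose) =
      tensorPow k U * tensorDeriv k X * (tensorPow k U).transpose := by
  rw [tensorDeriv_apply, tensorDeriv_apply, Finset.mul_sum, Finset.sum_mul]
  refine Finset.sum_congr rfl fun r _ => ?_
  rw [tensorPow_transpose, tensorPow, tensorPow, tensorProd_mul, tensorProd_mul]
  congr 1
  funext s
  rcases eq_or_ne s r with rfl | h
  · simp
  · simp [Function.update_of_ne h, hU]

theorem tensorDeriv_diagonal (a : Fin n → ℝ) :
    tensorDeriv k (Matrix.diagonal a) = Matrix.diagonal fun i => ∑ r, a (i r) := by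
  ext i j
  rw [tensorDeriv_apply, Matrix.sum_apply, Matrix.diagonal_apply]
  simp only [tensorProd_apply]
  split_ifs with h
  · subst h
    refine Finset.sum_congr rfl fun r _ => ?_
    rw [← Finset.mul_prod_erase _ _ (Finset.mem_univ r), Function.update_self,
      Matrix.diagonal_apply_eq, Finset.prod_eq_one, mul_one]
    intro s hs
    simp [Function.update_of_ne (Finset.ne_of_mem_erase hs)]
  · obtain ⟨r, hr⟩ := Function.ne_iff.1 h
    refine Finset.sum_eq_zero fun s _ => Finset.prod_eq_zero (Finset.mem_univ r) ?_
    rcases eq_or_ne r s with rfl | hs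
    · simp [Matrix.diagonal_apply_ne _ hr]
    · simp [Function.update_of_ne hs, Matrix.one_apply_ne hr]

/-- The action of an operator on `ℝ^n` on `(ℝ^n)^{⊗ k} ⊗ (ℝ^n)^{⊗ k}`. -/
def tensorConj (k : ℕ) (U : Matrix (Fin n) (Fin n) ℝ) : TensorMat n k →ₗ[ℝ] TensorMat n k where
  toFun f := tensorPow k U * f * (tensorPow k U).transpose
  map_add' f g := by rw [Matrix.mul_add, Matrix.add_mul]
  map_smul' c f := by simp

theorem tensorConj_apply (U : Matrix (Fin n) (Fin n) ℝ) (f : TensorMat n k) :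
    tensorConj k U f = tensorPow k U * f * (tensorPow k U).transpose := rfl

theorem tensorConj_one : tensorConj k (1 : Matrix (Fin n) (Fin n) ℝ) = LinearMap.id := by
  ext1 f
  simp [tensorConj_apply, tensorPow_one]

theorem tensorConj_mul (U U' : Matrix (Fin n) (Fin n) ℝ) (f : TensorMat n k) :
    tensorConj k (U * U') f = tensorConj k U (tensorConj k U' f) := by
  simp only [tensorConj_apply, tensorPow_mul, Matrix.transpose_mul, Matrix.mul_assoc]

/-- The symmetrized derivation of `(ℝ^n)^{⊗ k} ⊗ (ℝ^n)^{⊗ k}` given by a symmetric matrix. -/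
noncomputable def symDeriv (k : ℕ) : SymMat n →ₗ[ℝ] TensorMat n k →ₗ[ℝ] TensorMat n k :=
  LinearMap.mk₂ ℝ (fun X f => (1 / 2 : ℝ) • (tensorDeriv k X.1 * f + f * tensorDeriv k X.1))
    (fun X Y f => by
      simp only [Submodule.coe_add, map_add, Matrix.add_mul, Matrix.mul_add, smul_add]; abel)
    (fun c X f => by
      simp only [Submodule.coe_smul, map_smul, Matrix.smul_mul, Matrix.mul_smul, ← smul_add]
      rw [smul_comm])
    (fun X f g => by simp only [Matrix.add_mul, Matrix.mul_add, smul_add]; abel)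
    (fun c X f => by
      simp only [Matrix.smul_mul, Matrix.mul_smul, ← smul_add]
      rw [smul_comm])

theorem symDeriv_apply (X : SymMat n) (f : TensorMat n k) : symDeriv k X f =
    (1 / 2 : ℝ) • (tensorDeriv k X.1 * f + f * tensorDeriv k X.1) := rfl

theorem symDeriv_diag (a : Fin n → ℝ) (f : TensorMat n k) (i j : Fin k → Fin n) :
    symDeriv k (diag a) f i j = 1 / 2 * ((∑ r, a (i r)) + ∑ r, a (j r)) * f i j := by
  change ((1 / 2 : ℝ) • (tensorDeriv k (Matrix.diagonal a) * f +
    f * tensorDeriv k (Matrix.diagonal a))) i j = _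
  rw [tensorDeriv_diagonal]
  simp only [Matrix.smul_apply, Matrix.add_apply, Matrix.diagonal_mul, Matrix.mul_diagonal,
    smul_eq_mul]
  ring

theorem conjRep_coe (U : Matrix.orthogonalGroup (Fin n) ℝ) (X : SymMat n) :
    (conjRep n U X).1 = U.1 * X.1 * U.1.transpose := rfl

theorem orthogonal_mul_transpose (U : Matrix.orthogonalGroup (Fin n) ℝ) :
    U.1 * U.1.transpose = 1 := (Matrix.mem_orthogonalGroup_iff _ _).1 U.2

theorem orthogonal_transpose_mul (U : Matrix.orthogonalGroup (Fin n) ℝ) :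
    U.1.transpose * U.1 = 1 := (Matrix.mem_orthogonalGroup_iff' _ _).1 U.2

theorem symDeriv_conj (U : Matrix.orthogonalGroup (Fin n) ℝ) (X : SymMat n) (f : TensorMat n k) :
    symDeriv k (conjRep n U X) (tensorConj k U.1 f) = tensorConj k U.1 (symDeriv k X f) := by
  have h := tensorPow_transpose_mul (k := k) (orthogonal_transpose_mul U)
  rw [symDeriv_apply, symDeriv_apply, map_smul, conjRep_coe,
    tensorDeriv_conj (orthogonal_mul_transpose U), map_add, tensorConj_apply, tensorConj_apply,
    tensorConj_apply]
  generalize tensorPow k U.1 = K at *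
  congr 2
  · rw [show K * tensorDeriv k X.1 * K.transpose * (K * f * K.transpose) =
      K * tensorDeriv k X.1 * (K.transpose * K) * f * K.transpose by simp only [Matrix.mul_assoc], h]
    simp only [Matrix.mul_assoc, Matrix.mul_one]
  · rw [show K * f * K.transpose * (K * tensorDeriv k X.1 * K.transpose) =
      K * f * (K.transpose * K) * tensorDeriv k X.1 * K.transpose by simp only [Matrix.mul_assoc], h]
    simp only [Matrix.mul_assoc, Matrix.mul_one]

theorem sum_cons {M : Type*} [AddCommMonoid M] (F : (Fin (k + 1) → Fin n) → M) :
    ∑ i, F i = ∑ d, ∑ i : Fin k → Fin n, F (Fin.cons d i) := by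
  rw [← Equiv.sum_comp (Fin.consEquiv fun _ => Fin n), Fintype.sum_prod_type]
  rfl

/-- The contraction of the first indices of the two tensor factors. -/
def contract : TensorMat n (k + 1) →ₗ[ℝ] TensorMat n k where
  toFun f := Matrix.of fun i j => ∑ d, f (Fin.cons d i) (Fin.cons d j)
  map_add' f g := by ext i j; simp [Finset.sum_add_distrib]
  map_smul' c f := by ext i j; simp [Finset.mul_sum]

theorem contract_apply (f : TensorMat n (k + 1)) (i j : Fin k → Fin n) :
    contract f i j = ∑ d, f (Fin.cons d i) (Fin.cons d j) := rfl

/-- Orthogonality enters only through ∑_d U_{da} U_{db} = δ_{ab} for the contracted pair of indices;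
the rest is reordering of finite sums. -/
theorem contract_conj {U : Matrix (Fin n) (Fin n) ℝ} (hU : U.transpose * U = 1)
    (f : TensorMat n (k + 1)) :
    contract (tensorConj (k + 1) U f) = tensorConj k U (contract f) := by
  ext i j
  rw [contract_apply]
  simp only [tensorConj_apply, Matrix.mul_apply, Matrix.transpose_apply, sum_cons (k := k),
    tensorPow_cons, contract_apply]
  have hU' : ∀ a b, ∑ d, U d a * U d b = if a = b then 1 else 0 := by
    intro a b
    rw [← Matrix.one_apply, ← hU, Matrix.mul_apply]
    rfl
  calc ∑ d, ∑ b, ∑ q : Fin k → Fin n, (∑ a, ∑ p : Fin k → Fin n,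
          U d a * tensorPow k U i p * f (Fin.cons a p) (Fin.cons b q)) *
            (U d b * tensorPow k U j q)
      = ∑ q : Fin k → Fin n, ∑ p : Fin k → Fin n, ∑ a, ∑ b, (∑ d, U d a * U d b) *
          (tensorPow k U i p * f (Fin.cons a p) (Fin.cons b q) * tensorPow k U j q) := by
        simp only [Finset.sum_mul]
        rw [Finset.sum_comm' (t' := Finset.univ) (s' := fun _ => Finset.univ) (by simp)]
        rw [Finset.sum_congr rfl fun b _ => Finset.sum_comm]
        rw [Finset.sum_comm]
        refine Finset.sum_congr rfl fun q _ => ?_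
        rw [Finset.sum_congr rfl fun b _ => Finset.sum_congr rfl fun d _ => Finset.sum_comm]
        rw [Finset.sum_congr rfl fun b _ => Finset.sum_comm]
        rw [Finset.sum_comm]
        refine Finset.sum_congr rfl fun p _ => ?_
        rw [Finset.sum_congr rfl fun b _ => Finset.sum_comm]
        rw [Finset.sum_comm]
        refine Finset.sum_congr rfl fun a _ => Finset.sum_congr rfl fun b _ =>
          Finset.sum_congr rfl fun d _ => ?_
        ring
    _ = _ := by
        simp only [hU', ite_mul, one_mul, zero_mul, Finset.sum_ite_eq, Finset.mem_univ, if_true,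
          Finset.mul_sum, Finset.sum_mul]

/-- The standard inner product on `(ℝ^n)^{⊗ k} ⊗ (ℝ^n)^{⊗ k}`. -/
def tensorInner (n k : ℕ) : TensorMat n k →ₗ[ℝ] TensorMat n k →ₗ[ℝ] ℝ :=
  LinearMap.mk₂ ℝ (fun f g => (f.transpose * g).trace)
    (fun f f' g => by simp [Matrix.add_mul]) (fun c f g => by simp)
    (fun f g g' => by simp [Matrix.mul_add]) (fun c f g => by simp)

theorem tensorInner_def (f g : TensorMat n k) : tensorInner n k f g = (f.transpose * g).trace := rfl

theorem tensorInner_apply (f g : TensorMat n k) :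
    tensorInner n k f g = ∑ i, ∑ j, f i j * g i j := by
  rw [tensorInner_def, Matrix.trace, Finset.sum_comm]
  rfl

theorem tensorInner_conj {U : Matrix (Fin n) (Fin n) ℝ} (hU : U.transpose * U = 1)
    (f g : TensorMat n k) :
    tensorInner n k (tensorConj k U f) (tensorConj k U g) = tensorInner n k f g := by
  have h := tensorPow_transpose_mul (k := k) hU
  rw [tensorInner_def, tensorInner_def, tensorConj_apply, tensorConj_apply]
  generalize tensorPow k U = K at *
  rw [Matrix.transpose_mul, Matrix.transpose_mul, Matrix.transpose_transpose,
    show K * (f.transpose * K.transpose) * (K * g * K.transpose) =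
      K * (f.transpose * (K.transpose * K) * g * K.transpose) by simp only [Matrix.mul_assoc], h,
    Matrix.trace_mul_comm, Matrix.mul_one, Matrix.mul_assoc, h, Matrix.mul_one]

end Tensor
end SpectralLMI

/-! ### Blocks of alternating tensors -/

namespace SpectralLMI

/-- A pair of disjoint sets of labels of the same size. -/
abbrev Block (n : ℕ) : Type :=
  {J : Finset (Fin n) × Finset (Fin n) // Disjoint J.1 J.2 ∧ J.1.card = J.2.card}

namespace Block
variable {n : ℕ} (J : Block n)

theorem exists_swap : ∃ π : Fin n → Fin n, Function.Involutive π ∧ (∀ p ∈ J.1.1, π p ∈ J.1.2) ∧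
    (∀ p ∈ J.1.2, π p ∈ J.1.1) ∧ ∀ p, p ∉ J.1.1 → p ∉ J.1.2 → π p = p := by
  obtain ⟨⟨A, B⟩, hd, hc⟩ := J
  dsimp only at *
  let e : A ≃ B := Finset.equivOfCardEq hc
  let π : Fin n → Fin n := fun p =>
    if hA : p ∈ A then e ⟨p, hA⟩ else if hB : p ∈ B then e.symm ⟨p, hB⟩ else p
  have hπA : ∀ p (hA : p ∈ A), π p = e ⟨p, hA⟩ := fun p hA => dif_pos hA
  have hπB : ∀ p (hB : p ∈ B), π p = e.symm ⟨p, hB⟩ := fun p hB => by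
    simp only [π]
    rw [dif_neg (Finset.disjoint_right.1 hd hB), dif_pos hB]
  refine ⟨π, fun p => ?_, fun p hA => ?_, fun p hB => ?_, fun p hA hB => ?_⟩
  · by_cases hA : p ∈ A
    · rw [hπA p hA, hπB _ (e ⟨p, hA⟩).2]
      simp
    · by_cases hB : p ∈ B
      · rw [hπB p hB, hπA _ (e.symm ⟨p, hB⟩).2]
        simp
      · simp [π, hA, hB]
  · rw [hπA p hA]; exact (e ⟨p, hA⟩).2
  · rw [hπB p hB]; exact (e.symm ⟨p, hB⟩).2
  · simp [π, hA, hB]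

/-- An involution that exchanges the two sets of a block and fixes all other labels. -/
noncomputable def swap : Equiv.Perm (Fin n) := J.exists_swap.choose_spec.1.toPerm

theorem swap_swap (p : Fin n) : J.swap (J.swap p) = p := J.exists_swap.choose_spec.1 p

theorem swap_mem_right {p : Fin n} (hp : p ∈ J.1.1) : J.swap p ∈ J.1.2 :=
  J.exists_swap.choose_spec.2.1 p hp

theorem swap_mem_left {p : Fin n} (hp : p ∈ J.1.2) : J.swap p ∈ J.1.1 :=
  J.exists_swap.choose_spec.2.2.1 p hp

theorem swap_eq {p : Fin n} (h₁ : p ∉ J.1.1) (h₂ : p ∉ J.1.2) : J.swap p = p :=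
  J.exists_swap.choose_spec.2.2.2 p h₁ h₂

theorem notMem_right {p : Fin n} (hp : p ∈ J.1.1) : p ∉ J.1.2 :=
  Finset.disjoint_left.1 J.2.1 hp

/-- The map that moves the second set of a block to the first one. -/
noncomputable def left (p : Fin n) : Fin n := if p ∈ J.1.2 then J.swap p else p

/-- The map that moves the first set of a block to the second one. -/
noncomputable def right (p : Fin n) : Fin n := if p ∈ J.1.1 then J.swap p else p

theorem cases (p : Fin n) : (p ∈ J.1.1 ∧ p ∉ J.1.2) ∨ (p ∉ J.1.1 ∧ p ∈ J.1.2) ∨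
    (p ∉ J.1.1 ∧ p ∉ J.1.2) := by
  have := @notMem_right n J p
  tauto

theorem swap_left (p : Fin n) : J.swap (J.left p) = J.right p := by
  rcases J.cases p with ⟨h₁, h₂⟩ | ⟨h₁, h₂⟩ | ⟨h₁, h₂⟩ <;>
    simp [left, right, h₁, h₂, swap_swap, J.swap_eq]

theorem left_swap (p : Fin n) : J.left (J.swap p) = J.left p := by
  rcases J.cases p with ⟨h₁, h₂⟩ | ⟨h₁, h₂⟩ | ⟨h₁, h₂⟩
  · simp [left, h₂, J.swap_mem_right h₁, swap_swap]
  · simp [left, h₂, J.notMem_right (J.swap_mem_left h₂)]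
  · simp [J.swap_eq h₁ h₂]

theorem right_swap (p : Fin n) : J.right (J.swap p) = J.right p := by
  rw [← swap_left, left_swap, swap_left]

theorem left_notMem (p : Fin n) : J.left p ∉ J.1.2 := by
  rw [left]
  split_ifs with h
  · exact J.notMem_right (J.swap_mem_left h)
  · exact h

theorem left_eq_self {p : Fin n} (h : p ∉ J.1.2) : J.left p = p := if_neg h

theorem add_left_right (a : Fin n → ℝ) (p : Fin n) :
    a (J.left p) + a (J.right p) = a p + a (J.swap p) := by
  rcases J.cases p with ⟨h₁, h₂⟩ | ⟨h₁, h₂⟩ | ⟨h₁, h₂⟩ <;>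
    simp [left, right, h₁, h₂, J.swap_eq, add_comm]

/-- The sign that is `-1` on the second set of a block. -/
def sign (p : Fin n) : ℝ := if p ∈ J.1.2 then -1 else 1

/-- The sign that is `-1` on both sets of a block. -/
def totalSign (p : Fin n) : ℝ := if p ∈ J.1.1 ∨ p ∈ J.1.2 then -1 else 1

theorem sign_mul_self (p : Fin n) : J.sign p * J.sign p = 1 := by
  rw [sign]; split_ifs <;> norm_num

theorem sign_swap (p : Fin n) : J.sign (J.swap p) = J.totalSign p * J.sign p := by
  rcases J.cases p with ⟨h₁, h₂⟩ | ⟨h₁, h₂⟩ | ⟨h₁, h₂⟩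
  · simp [sign, totalSign, h₁, h₂, J.swap_mem_right h₁]
  · simp [sign, totalSign, h₁, h₂, J.notMem_right (J.swap_mem_left h₂)]
  · simp [sign, totalSign, h₁, h₂, J.swap_eq h₁ h₂]

theorem totalSign_left (p : Fin n) : J.totalSign (J.left p) = J.totalSign p := by
  rcases J.cases p with ⟨h₁, h₂⟩ | ⟨h₁, h₂⟩ | ⟨h₁, h₂⟩
  · simp [left, h₂]
  · simp [left, totalSign, h₂, J.swap_mem_left h₂]
  · simp [left, h₂]

end Block

/-- Alternating in each of the two tensor factors. -/
def IsAlt {n k : ℕ} (f : TensorMat n k) : Prop :=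
  (∀ (σ : Equiv.Perm (Fin k)) i j, f (i ∘ σ) j = ((Equiv.Perm.sign σ : ℤ) : ℝ) * f i j) ∧
  ∀ (σ : Equiv.Perm (Fin k)) i j, f i (j ∘ σ) = ((Equiv.Perm.sign σ : ℤ) : ℝ) * f i j

theorem comp_swap_eq {α : Type*} {k : ℕ} {i : Fin k → α} {r s : Fin k} (h : i r = i s) :
    i ∘ Equiv.swap r s = i := by
  funext t
  rcases eq_or_ne t r with rfl | hr
  · simp [h]
  rcases eq_or_ne t s with rfl | hs
  · simp [h]
  · simp [Equiv.swap_apply_of_ne_of_ne hr hs]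

theorem sign_mul_sign {k : ℕ} (σ : Equiv.Perm (Fin k)) :
    ((Equiv.Perm.sign σ : ℤ) : ℝ) * ((Equiv.Perm.sign σ : ℤ) : ℝ) = 1 := by
  rcases Int.units_eq_one_or (Equiv.Perm.sign σ) with h | h <;> simp [h]

namespace IsAlt
variable {n k : ℕ} {f g : TensorMat n k}

theorem eq_zero_left (hf : IsAlt f) {i : Fin k → Fin n} (hi : ¬ Function.Injective i)
    (j : Fin k → Fin n) : f i j = 0 := by
  simp only [Function.Injective, not_forall] at hi
  obtain ⟨r, s, hrs, hne⟩ := hi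
  have := hf.1 (Equiv.swap r s) i j
  rw [comp_swap_eq hrs, Equiv.Perm.sign_swap hne] at this
  push_cast at this
  linarith

theorem eq_zero_right (hf : IsAlt f) {j : Fin k → Fin n} (hj : ¬ Function.Injective j)
    (i : Fin k → Fin n) : f i j = 0 := by
  simp only [Function.Injective, not_forall] at hj
  obtain ⟨r, s, hrs, hne⟩ := hj
  have := hf.2 (Equiv.swap r s) i j
  rw [comp_swap_eq hrs, Equiv.Perm.sign_swap hne] at this
  push_cast at this
  linarith

theorem comp_comp (hf : IsAlt f) (σ : Equiv.Perm (Fin k)) (i j : Fin k → Fin n) :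
    f (i ∘ σ) (j ∘ σ) = f i j := by
  rw [hf.1, hf.2, ← mul_assoc, sign_mul_sign, one_mul]

theorem mul_comp_right (hf : IsAlt f) (hg : IsAlt g) (σ : Equiv.Perm (Fin k))
    (i j : Fin k → Fin n) : f i (j ∘ σ) * g i (j ∘ σ) = f i j * g i j := by
  rw [hf.2, hg.2, mul_mul_mul_comm, sign_mul_sign, one_mul]

theorem symDeriv_diag (hf : IsAlt f) (a : Fin n → ℝ) : IsAlt (symDeriv k (diag a) f) := by
  refine ⟨fun σ i j => ?_, fun σ i j => ?_⟩
  · rw [SpectralLMI.symDeriv_diag, SpectralLMI.symDeriv_diag, hf.1]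
    simp only [Function.comp_apply, Equiv.sum_comp σ fun r => a (i r)]
    ring
  · rw [SpectralLMI.symDeriv_diag, SpectralLMI.symDeriv_diag, hf.2]
    simp only [Function.comp_apply, Equiv.sum_comp σ fun r => a (j r)]
    ring

end IsAlt

theorem cons_comp_perm {α : Type*} {k : ℕ} (σ : Equiv.Perm (Fin k)) (d : α) (i : Fin k → α) :
    (Fin.cons d (i ∘ σ) : Fin (k + 1) → α) =
      (Fin.cons d i : Fin (k + 1) → α) ∘ Equiv.Perm.decomposeFin.symm (0, σ) := by
  funext r
  cases r using Fin.cases with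
  | zero => simp
  | succ r => simp

theorem IsAlt.contract {n k : ℕ} {f : TensorMat n (k + 1)} (hf : IsAlt f) :
    IsAlt (contract f) := by
  refine ⟨fun σ i j => ?_, fun σ i j => ?_⟩ <;>
    simp only [contract_apply, Finset.mul_sum, cons_comp_perm] <;>
    refine Finset.sum_congr rfl fun d _ => ?_
  · rw [hf.1]; simp [Equiv.Perm.decomposeFin.symm_sign]
  · rw [hf.2]; simp [Equiv.Perm.decomposeFin.symm_sign]

namespace Block
variable {n k : ℕ} (J : Block n)

theorem left_comp_swap (i : Fin k → Fin n) : J.left ∘ J.swap ∘ i = J.left ∘ i :=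
  funext fun r => J.left_swap (i r)

theorem right_comp_swap (i : Fin k → Fin n) : J.right ∘ J.swap ∘ i = J.right ∘ i :=
  funext fun r => J.right_swap (i r)

theorem swap_comp_left (i : Fin k → Fin n) : J.swap ∘ J.left ∘ i = J.right ∘ i :=
  funext fun r => J.swap_left (i r)

/-- The component of a tensor in a block, as a function of `k`-tuples. It is supported on
tuples that contain exactly one of `p` and `J.swap p` for every `p` in the first set, and changes
sign if one of them is replaced by the other one. -/
noncomputable def comp : TensorMat n k →ₗ[ℝ] ((Fin k → Fin n) → ℝ) where
  toFun f i := if J.1.1 ⊆ Finset.univ.image (J.left ∘ i) then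
    (∏ r, J.sign (i r)) * f (J.left ∘ i) (J.right ∘ i) else 0
  map_add' f g := by
    funext i
    simp only [Matrix.add_apply, Pi.add_apply]
    split_ifs <;> ring
  map_smul' c f := by
    funext i
    simp only [Matrix.smul_apply, Pi.smul_apply, smul_eq_mul, RingHom.id_apply]
    split_ifs <;> ring

theorem comp_apply (f : TensorMat n k) (i : Fin k → Fin n) :
    J.comp f i = if J.1.1 ⊆ Finset.univ.image (J.left ∘ i) then
      (∏ r, J.sign (i r)) * f (J.left ∘ i) (J.right ∘ i) else 0 := rfl

/-- Alternation in both factors is needed: reordering the tuple produces the same sign twice, so the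
component is symmetric, while repetitions still give zero. -/
theorem comp_mem_setFun {f : TensorMat n k} (hf : IsAlt f) : J.comp f ∈ setFun n k := by
  refine ⟨fun σ i => ?_, fun i hi => ?_⟩
  · rw [comp_apply, comp_apply, ← Function.comp_assoc, ← Function.comp_assoc, image_comp_perm,
      hf.comp_comp]
    simp only [Function.comp_apply, Equiv.prod_comp σ fun r => J.sign (i r)]
  · rw [comp_apply, hf.eq_zero_left (fun h => hi h.of_comp), mul_zero, ite_self]

/-- On the support the tuple meets each matched pair in exactly one entry, so the swap changes the
sign of exactly |A| factors, where A is the first set of the block. -/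
theorem comp_swap {f : TensorMat n k} (hf : IsAlt f) (i : Fin k → Fin n) :
    J.comp f (J.swap ∘ i) = (-1) ^ J.1.1.card * J.comp f i := by
  rw [comp_apply, comp_apply, left_comp_swap, right_comp_swap]
  by_cases h : J.1.1 ⊆ Finset.univ.image (J.left ∘ i)
  · rw [if_pos h, if_pos h]
    by_cases hi : Function.Injective (J.left ∘ i)
    · have h1 : ∏ r, J.totalSign (i r) = (-1) ^ J.1.1.card := by
        calc ∏ r, J.totalSign (i r) = ∏ r, J.totalSign ((J.left ∘ i) r) :=
              Finset.prod_congr rfl fun r _ => (J.totalSign_left (i r)).symm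
          _ = ∏ p ∈ Finset.univ.image (J.left ∘ i), J.totalSign p :=
              (Finset.prod_image fun r _ s _ h => hi h).symm
          _ = ∏ p ∈ J.1.1, J.totalSign p := by
              refine (Finset.prod_subset h fun p hp hp1 => ?_).symm
              obtain ⟨r, -, rfl⟩ := Finset.mem_image.1 hp
              rw [totalSign, if_neg]
              exact not_or.2 ⟨hp1, J.left_notMem _⟩
          _ = _ := by
              rw [Finset.prod_congr rfl fun p hp => ?_, Finset.prod_const]
              simp [totalSign, hp]
      simp only [Function.comp_apply, sign_swap, Finset.prod_mul_distrib, h1]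
      ring
    · rw [hf.eq_zero_left hi]; ring
  · rw [if_neg h, if_neg h, mul_zero]

/-- The product of two block components. -/
theorem comp_mul_comp (f g : TensorMat n k) (i : Fin k → Fin n) :
    J.comp f i * J.comp g i = if J.1.1 ⊆ Finset.univ.image (J.left ∘ i) then
      f (J.left ∘ i) (J.right ∘ i) * g (J.left ∘ i) (J.right ∘ i) else 0 := by
  rw [comp_apply, comp_apply]
  split_ifs
  · rw [mul_mul_mul_comm, ← Finset.prod_mul_distrib]
    simp [sign_mul_self]
  · simp

end Block

/-- The contraction of the first index of a function of tuples. -/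
def sumCons (n k : ℕ) : ((Fin (k + 1) → Fin n) → ℝ) →ₗ[ℝ] ((Fin k → Fin n) → ℝ) where
  toFun v i := ∑ d, v (Fin.cons d i)
  map_add' v w := by funext i; simp [Finset.sum_add_distrib]
  map_smul' c v := by funext i; simp [Finset.mul_sum]

theorem sumCons_apply {n k : ℕ} (v : (Fin (k + 1) → Fin n) → ℝ) (i : Fin k → Fin n) :
    sumCons n k v i = ∑ d, v (Fin.cons d i) := rfl

theorem comp_cons {α β : Type*} {k : ℕ} (u : α → β) (d : α) (i : Fin k → α) :
    u ∘ (Fin.cons d i : Fin (k + 1) → α) = (Fin.cons (u d) (u ∘ i) : Fin (k + 1) → β) := by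
  funext r
  cases r using Fin.cases <;> simp

theorem image_cons {α : Type*} [DecidableEq α] {k : ℕ} (d : α) (i : Fin k → α) :
    Finset.univ.image (Fin.cons d i : Fin (k + 1) → α) = insert d (Finset.univ.image i) := by
  ext x
  simp [Fin.exists_fin_succ, eq_comm]

theorem not_injective_cons {α : Type*} [DecidableEq α] {k : ℕ} {d : α} {i : Fin k → α}
    (h : d ∈ Finset.univ.image i) : ¬ Function.Injective (Fin.cons d i : Fin (k + 1) → α) := by
  intro hi
  obtain ⟨r, -, hr⟩ := Finset.mem_image.1 h
  have := @hi r.succ 0 (by simpa using hr)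
  exact Fin.succ_ne_zero r this

/-- If the tuple already meets every matched pair, a new entry d in A ∪ B produces a repeated index
on both sides, and any other d gives equal terms. If some pair is missed, the right side is zero and
the left side cancels in pairs. -/
theorem Block.sumCons_comp {n k : ℕ} (J : Block n) {f : TensorMat n (k + 1)} (hf : IsAlt f) :
    sumCons n k (J.comp f) = J.comp (contract f) := by
  funext i
  rw [sumCons_apply, J.comp_apply]
  by_cases h : J.1.1 ⊆ Finset.univ.image (J.left ∘ i)
  · rw [if_pos h, contract_apply, Finset.mul_sum]
    refine Finset.sum_congr rfl fun d _ => ?_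
    rw [J.comp_apply, comp_cons, comp_cons, image_cons, if_pos (h.trans (Finset.subset_insert _ _)),
      Fin.prod_univ_succ]
    simp only [Fin.cons_zero, Fin.cons_succ]
    rcases J.cases d with ⟨h₁, h₂⟩ | ⟨h₁, h₂⟩ | ⟨h₁, h₂⟩
    · rw [J.left_eq_self h₂, hf.eq_zero_left (not_injective_cons (h h₁)),
        hf.eq_zero_left (not_injective_cons (h h₁))]
      simp
    · have h3 : J.left d ∈ J.1.1 := by
        rw [Block.left, if_pos h₂]; exact J.swap_mem_left h₂
      have h4 : d ∈ Finset.univ.image (J.right ∘ i) := by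
        obtain ⟨r, -, hr⟩ := Finset.mem_image.1 (h (J.swap_mem_left h₂))
        refine Finset.mem_image.2 ⟨r, Finset.mem_univ _, ?_⟩
        rw [Function.comp_apply, ← J.swap_left, ← Function.comp_apply (f := J.left), hr,
          J.swap_swap]
      rw [hf.eq_zero_left (not_injective_cons (h h3)), hf.eq_zero_right (not_injective_cons h4)]
      simp
    · rw [J.left_eq_self h₂, show J.right d = d from if_neg h₁, Block.sign, if_neg h₂, one_mul]
  · rw [if_neg h]
    obtain ⟨p, hp, hpi⟩ := Finset.not_subset.1 h
    -- A term is nonzero only if d is an element of the missed pair. The two choices of d have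
    -- opposite signs, so the sum over d equals its own negative.
    have key : ∀ d, J.comp f (Fin.cons (J.swap d) i : Fin (k + 1) → Fin n) =
        - J.comp f (Fin.cons d i : Fin (k + 1) → Fin n) := by
      intro d
      rw [J.comp_apply, J.comp_apply, comp_cons, comp_cons, comp_cons, comp_cons, J.left_swap,
        J.right_swap, Fin.prod_univ_succ, Fin.prod_univ_succ]
      simp only [Fin.cons_zero, Fin.cons_succ]
      split_ifs with h5
      · have h6 : J.left d = p := by
          have := h5 hp
          rw [image_cons, Finset.mem_insert] at this
          exact (this.resolve_right hpi).symm
        have h7 : d ∈ J.1.1 ∨ d ∈ J.1.2 := by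
          rw [Block.left] at h6
          split_ifs at h6 with h8
          · exact Or.inr h8
          · exact Or.inl (h6 ▸ hp)
        rw [J.sign_swap, Block.totalSign, if_pos h7]
        ring
      · simp
    have h8 := Equiv.sum_comp J.swap fun d => J.comp f (Fin.cons d i : Fin (k + 1) → Fin n)
    simp only [key, Finset.sum_neg_distrib] at h8
    linarith

end SpectralLMI

/-! ### The inner product as a weighted sum over blocks -/

namespace SpectralLMI

theorem exists_perm_of_image_eq {α : Type*} [DecidableEq α] {k : ℕ} {i j : Fin k → α}
    (hi : Function.Injective i)
    (h : Finset.univ.image i = Finset.univ.image j) : ∃ σ : Equiv.Perm (Fin k), i = j ∘ σ := by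
  have h1 : ∀ r, ∃ s, j s = i r := fun r => by
    have := h ▸ Finset.mem_image_of_mem i (Finset.mem_univ r)
    simpa using this
  choose σ hσ using h1
  have hσi : Function.Injective σ := fun r s hrs => hi (by rw [← hσ, ← hσ, hrs])
  exact ⟨Equiv.ofBijective σ (Finite.injective_iff_bijective.1 hσi),
    funext fun r => (hσ r).symm⟩

theorem sum_image_eq {n k : ℕ} {F : (Fin k → Fin n) → ℝ} (hF : F ∈ setFun n k)
    {c : Fin k → Fin n} (hc : Function.Injective c) :
    ∑ j with Finset.univ.image j = Finset.univ.image c, F j = (k.factorial : ℝ) * F c := by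
  have h1 : ∑ σ : Equiv.Perm (Fin k), F (c ∘ σ) = (k.factorial : ℝ) * F c := by
    simp [hF.1, Fintype.card_perm]
  rw [← h1]
  symm
  refine Finset.sum_of_injOn (fun σ : Equiv.Perm (Fin k) => c ∘ σ) ?_ ?_ ?_ ?_
  · intro σ _ τ _ h
    exact Equiv.ext fun r => hc (congrFun h r)
  · intro σ _
    simp [image_comp_perm]
  · intro j hj hj'
    refine hF.2 j fun hji => hj' ?_
    obtain ⟨σ, rfl⟩ := exists_perm_of_image_eq hji (by simpa using hj)
    exact ⟨σ, by simp, rfl⟩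
  · intro σ _
    rfl

namespace Block
variable {n k : ℕ} (J : Block n)

theorem image_swap_comp {c : Fin k → Fin n} (h₁ : J.1.1 ⊆ Finset.univ.image c)
    (h₂ : ∀ r, c r ∉ J.1.2) :
    Finset.univ.image (J.swap ∘ c) = (Finset.univ.image c \ J.1.1) ∪ J.1.2 := by
  ext x
  rw [Finset.mem_union, Finset.mem_sdiff]
  constructor
  · intro hx
    obtain ⟨r, -, rfl⟩ := Finset.mem_image.1 hx
    by_cases h : c r ∈ J.1.1
    · exact Or.inr (J.swap_mem_right h)
    · rw [Function.comp_apply, J.swap_eq h (h₂ r)]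
      exact Or.inl ⟨Finset.mem_image_of_mem _ (Finset.mem_univ _), h⟩
  · rintro (⟨hx, hx1⟩ | hx)
    · obtain ⟨r, -, rfl⟩ := Finset.mem_image.1 hx
      exact Finset.mem_image.2 ⟨r, Finset.mem_univ _, J.swap_eq hx1 (h₂ r)⟩
    · obtain ⟨r, -, hr⟩ := Finset.mem_image.1 (h₁ (J.swap_mem_left hx))
      exact Finset.mem_image.2 ⟨r, Finset.mem_univ _, by
        rw [Function.comp_apply, hr, J.swap_swap]⟩

theorem card_fiber_left (p : Fin n) (hp : p ∉ J.1.2) :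
    (Finset.univ.filter fun d => J.left d = p).card = if p ∈ J.1.1 then 2 else 1 := by
  split_ifs with h
  · have h1 : J.swap p ∈ J.1.2 := J.swap_mem_right h
    have h2 : p ≠ J.swap p := fun h3 => hp (by rw [h3]; exact h1)
    rw [show (Finset.univ.filter fun d => J.left d = p) = {p, J.swap p} from ?_,
      Finset.card_pair h2]
    ext d
    simp only [Finset.mem_filter, Finset.mem_univ, true_and, Finset.mem_insert,
      Finset.mem_singleton]
    constructor
    · intro hd
      rw [left] at hd
      split_ifs at hd
      · right; rw [← hd, J.swap_swap]
      · exact Or.inl hd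
    · rintro (rfl | rfl)
      · exact J.left_eq_self hp
      · rw [J.left_swap, J.left_eq_self hp]
  · rw [show (Finset.univ.filter fun d => J.left d = p) = {p} from ?_, Finset.card_singleton]
    ext d
    simp only [Finset.mem_filter, Finset.mem_univ, true_and, Finset.mem_singleton]
    constructor
    · intro hd
      rw [left] at hd
      split_ifs at hd with h1
      · exact absurd (hd ▸ J.swap_mem_left h1) h
      · exact hd
    · rintro rfl
      exact J.left_eq_self hp

theorem card_fiber_left_comp {c : Fin k → Fin n} (hc : Function.Injective c)
    (h₁ : J.1.1 ⊆ Finset.univ.image c) (h₂ : ∀ r, c r ∉ J.1.2) :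
    (Finset.univ.filter fun i : Fin k → Fin n => J.left ∘ i = c).card = 2 ^ J.1.1.card := by
  have h3 : (Finset.univ.filter fun i : Fin k → Fin n => J.left ∘ i = c) =
      Fintype.piFinset fun r => Finset.univ.filter fun d => J.left d = c r := by
    ext i
    simp [funext_iff]
  rw [h3, Fintype.card_piFinset]
  simp only [J.card_fiber_left _ (h₂ _)]
  rw [← Finset.prod_image (s := Finset.univ) (g := c) (f := fun p => if p ∈ J.1.1 then 2 else 1)
    fun r _ s _ h => hc h, ← Finset.prod_subset h₁]
  · rw [Finset.prod_congr rfl fun p hp => if_pos hp, Finset.prod_const]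
  · intro p _ hp
    exact if_neg hp

/-- The tuples are grouped by their image under `J.left`. Each injective c that avoids the second
set and contains the first has 2^|A| preimages, one binary choice per matched pair. The weight
2^{-|A|} in the block decompositions compensates for this count. -/
theorem sum_left_comp {F : (Fin k → Fin n) → ℝ} (hF : ∀ c, ¬ Function.Injective c → F c = 0) :
    ∑ i, (if J.1.1 ⊆ Finset.univ.image (J.left ∘ i) then F (J.left ∘ i) else 0) =
      2 ^ J.1.1.card * ∑ c, if J.1.1 ⊆ Finset.univ.image c ∧ ∀ r, c r ∉ J.1.2 then F c else 0 := by
  rw [← Finset.sum_fiberwise Finset.univ fun i : Fin k → Fin n => J.left ∘ i, Finset.mul_sum]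
  refine Finset.sum_congr rfl fun c _ => ?_
  have h1 : ∀ i ∈ Finset.univ.filter (fun i : Fin k → Fin n => J.left ∘ i = c),
      (if J.1.1 ⊆ Finset.univ.image (J.left ∘ i) then F (J.left ∘ i) else 0) =
        if J.1.1 ⊆ Finset.univ.image c then F c else 0 := by
    intro i hi
    rw [(Finset.mem_filter.1 hi).2]
  rw [Finset.sum_congr rfl h1, Finset.sum_const, nsmul_eq_mul]
  by_cases hc : Function.Injective c
  · by_cases h₁ : J.1.1 ⊆ Finset.univ.image c
    · by_cases h₂ : ∀ r, c r ∉ J.1.2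
      · rw [J.card_fiber_left_comp hc h₁ h₂, if_pos h₁, if_pos ⟨h₁, h₂⟩]
        push_cast
        rfl
      · have h3 : ¬ (J.1.1 ⊆ Finset.univ.image c ∧ ∀ r, c r ∉ J.1.2) := fun h => h₂ h.2
        rw [if_neg h3, Finset.card_eq_zero.2, Nat.cast_zero, zero_mul, mul_zero]
        rw [Finset.filter_eq_empty_iff]
        rintro i - rfl
        exact h₂ fun r => J.left_notMem _
    · rw [if_neg h₁, if_neg (fun h => h₁ h.1), mul_zero, mul_zero]
  · simp [hF c hc]

end Block

theorem eq_sdiff_and_eq_sdiff_iff {α : Type*} [DecidableEq α] {A B C D : Finset α} (hA : A ⊆ C)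
    (hB : Disjoint B C) : A = C \ D ∧ B = D \ C ↔ D = (C \ A) ∪ B := by
  have h1 := @Finset.disjoint_left _ B C
  constructor
  · rintro ⟨rfl, rfl⟩
    ext x
    simp only [Finset.mem_union, Finset.mem_sdiff]
    tauto
  · rintro rfl
    constructor
    · ext x
      have h2 := @hA x
      have h3 : x ∈ B → x ∉ C := fun hx => h1.1 hB hx
      simp only [Finset.mem_union, Finset.mem_sdiff]
      clear h1 hA hB
      tauto
    · ext x
      have h2 := @hA x
      have h3 : x ∈ B → x ∉ C := fun hx => h1.1 hB hx
      simp only [Finset.mem_union, Finset.mem_sdiff]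
      clear h1 hA hB
      tauto

/-- With c fixed, an injective j determines one block by the two set differences. Conversely, a
block compatible with c determines the set of entries of j as that of `J.swap ∘ c`, and this set has
k! enumerations. -/
theorem sum_eq_sum_block {n k : ℕ} {F : (Fin k → Fin n) → ℝ} (hF : F ∈ setFun n k)
    {c : Fin k → Fin n} (hc : Function.Injective c) :
    ∑ j, F j = (k.factorial : ℝ) * ∑ J : Block n,
      if J.1.1 ⊆ Finset.univ.image c ∧ ∀ r, c r ∉ J.1.2 then F (J.swap ∘ c) else 0 := by
  have h1 : ∀ j, F j = ∑ J : Block n, if J.1.1 = Finset.univ.image c \ Finset.univ.image j ∧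
      J.1.2 = Finset.univ.image j \ Finset.univ.image c then F j else 0 := by
    intro j
    by_cases hj : Function.Injective j
    · let J₀ : Block n := ⟨(Finset.univ.image c \ Finset.univ.image j,
          Finset.univ.image j \ Finset.univ.image c),
        Finset.disjoint_left.2 fun x hx hx' => (Finset.mem_sdiff.1 hx).2 (Finset.mem_sdiff.1 hx').1,
        Finset.card_sdiff_comm (by
          rw [Finset.card_image_of_injective _ hc, Finset.card_image_of_injective _ hj])⟩
      rw [Finset.sum_eq_single J₀]
      · exact (if_pos ⟨rfl, rfl⟩).symm
      · intro J _ hJ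
        exact if_neg fun h => hJ (Subtype.ext (Prod.ext h.1 h.2))
      · simp
    · simp [hF.2 j hj]
  rw [Finset.sum_congr rfl fun j _ => h1 j, Finset.sum_comm, Finset.mul_sum]
  refine Finset.sum_congr rfl fun J _ => ?_
  rw [← Finset.sum_filter]
  by_cases h : J.1.1 ⊆ Finset.univ.image c ∧ ∀ r, c r ∉ J.1.2
  · rw [if_pos h, ← sum_image_eq hF (J.swap.injective.comp hc)]
    refine Finset.sum_congr ?_ fun _ _ => rfl
    ext j
    rw [Finset.mem_filter, Finset.mem_filter, J.image_swap_comp h.1 h.2]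
    simp only [Finset.mem_univ, true_and]
    have h2 : Disjoint J.1.2 (Finset.univ.image c) := by
      refine Finset.disjoint_right.2 fun x hx => ?_
      obtain ⟨r, -, rfl⟩ := Finset.mem_image.1 hx
      exact h.2 r
    exact eq_sdiff_and_eq_sdiff_iff h.1 h2
  · rw [if_neg h, mul_zero, Finset.sum_eq_zero]
    intro j hj
    obtain ⟨-, hj1, hj2⟩ := Finset.mem_filter.1 hj
    refine absurd ⟨?_, fun r hr => ?_⟩ h
    · rw [hj1]; exact Finset.sdiff_subset
    · rw [hj2] at hr
      exact (Finset.mem_sdiff.1 hr).2 (Finset.mem_image_of_mem _ (Finset.mem_univ r))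

/-- For each first index c, `sum_eq_sum_block` sorts the second indices by block; within a block,
`sum_left_comp` rewrites the sum over c through block components. Products of two components carry
no signs. -/
theorem tensorInner_eq_sum_block {n k : ℕ} {f g : TensorMat n k} (hf : IsAlt f) (hg : IsAlt g) :
    tensorInner n k f g = (k.factorial : ℝ) * ∑ J : Block n, (1 / 2 : ℝ) ^ J.1.1.card *
      ∑ i, J.comp f i * J.comp g i := by
  have h1 : ∀ J : Block n, (1 / 2 : ℝ) ^ J.1.1.card * ∑ i, J.comp f i * J.comp g i =
      ∑ c : Fin k → Fin n, if J.1.1 ⊆ Finset.univ.image c ∧ ∀ r, c r ∉ J.1.2 then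
        f c (J.swap ∘ c) * g c (J.swap ∘ c) else 0 := by
    intro J
    simp only [J.comp_mul_comp, ← J.swap_comp_left]
    rw [J.sum_left_comp (F := fun c => f c (J.swap ∘ c) * g c (J.swap ∘ c)), ← mul_assoc,
      ← mul_pow]
    · norm_num
    · intro c hc
      rw [hf.eq_zero_left hc, zero_mul]
  rw [Finset.sum_congr rfl fun J _ => h1 J, Finset.sum_comm, Finset.mul_sum, tensorInner_apply]
  refine Finset.sum_congr rfl fun c _ => ?_
  by_cases hc : Function.Injective c
  · refine sum_eq_sum_block (F := fun j => f c j * g c j) ⟨fun σ j => ?_, fun j hj => ?_⟩ hc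
    · exact hf.mul_comp_right hg σ c j
    · change f c j * g c j = 0
      rw [hf.eq_zero_right hj, zero_mul]
  · simp [hf.eq_zero_left hc]

end SpectralLMI

/-! ### Bilinear forms on functions of sets that lift to tensors -/

namespace SpectralLMI
variable {n k : ℕ}

/-- An `O(n)`-invariant bilinear form `B` on tensors that decomposes over the blocks into copies
of a permutation-invariant bilinear form `q` on functions of tuples. -/
structure IsInvariantLift (B : TensorMat n k →ₗ[ℝ] TensorMat n k →ₗ[ℝ] ℝ)
    (q : ((Fin k → Fin n) → ℝ) → ((Fin k → Fin n) → ℝ) → ℝ) : Prop where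
  conj : ∀ (U : Matrix.orthogonalGroup (Fin n) ℝ) f g,
    B (tensorConj k U.1 f) (tensorConj k U.1 g) = B f g
  block : ∀ f g, IsAlt f → IsAlt g →
    B f g = ∑ J : Block n, (1 / 2 : ℝ) ^ J.1.1.card * q (J.comp f) (J.comp g)
  perm : ∀ (π : Equiv.Perm (Fin n)) u v, q (fun i => u (π ∘ i)) (fun i => v (π ∘ i)) = q u v
  add_left : ∀ u u' v, q (u + u') v = q u v + q u' v
  add_right : ∀ u v v', q u (v + v') = q u v + q u v'
  smul_left : ∀ (c : ℝ) u v, q (c • u) v = c * q u v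
  smul_right : ∀ (c : ℝ) u v, q u (c • v) = c * q u v

/-- An `O(n)`-equivariant family `L` of bilinear forms on tensors that at diagonal matrices
decomposes over the blocks into copies of the bilinear forms `q a` on functions of tuples. -/
structure IsLift (L : SymMat n →ₗ[ℝ] TensorMat n k →ₗ[ℝ] TensorMat n k →ₗ[ℝ] ℝ)
    (q : (Fin n → ℝ) → ((Fin k → Fin n) → ℝ) → ((Fin k → Fin n) → ℝ) → ℝ) : Prop where
  conj : ∀ (U : Matrix.orthogonalGroup (Fin n) ℝ) X f g,
    L (conjRep n U X) (tensorConj k U.1 f) (tensorConj k U.1 g) = L X f g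
  block : ∀ a f g, IsAlt f → IsAlt g →
    L (diag a) f g = ∑ J : Block n, (1 / 2 : ℝ) ^ J.1.1.card * q a (J.comp f) (J.comp g)

/-- A family of bilinear forms on functions of tuples is liftable if it lifts to tensors. -/
def Liftable (q : (Fin n → ℝ) → ((Fin k → Fin n) → ℝ) → ((Fin k → Fin n) → ℝ) → ℝ) : Prop :=
  ∃ L, IsLift L q

/-- Block components of alternating tensors always lie in `setFun n k`, so the values of the form
elsewhere are irrelevant. -/
theorem Liftable.congr
    {q q' : (Fin n → ℝ) → ((Fin k → Fin n) → ℝ) → ((Fin k → Fin n) → ℝ) → ℝ}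
    (hq : Liftable q) (h : ∀ a, ∀ u ∈ setFun n k, ∀ v ∈ setFun n k, q a u v = q' a u v) :
    Liftable q' := by
  obtain ⟨L, hL⟩ := hq
  refine ⟨L, hL.conj, fun a f g hf hg => (hL.block a f g hf hg).trans ?_⟩
  exact Finset.sum_congr rfl fun J _ => by
    rw [h a _ (J.comp_mem_setFun hf) _ (J.comp_mem_setFun hg)]

theorem Liftable.add
    {q q' : (Fin n → ℝ) → ((Fin k → Fin n) → ℝ) → ((Fin k → Fin n) → ℝ) → ℝ}
    (hq : Liftable q) (hq' : Liftable q') : Liftable fun a u v => q a u v + q' a u v := by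
  obtain ⟨L, hL⟩ := hq
  obtain ⟨L', hL'⟩ := hq'
  refine ⟨L + L', fun U X f g => ?_, fun a f g hf hg => ?_⟩
  · simp only [LinearMap.add_apply, hL.conj, hL'.conj]
  · simp only [LinearMap.add_apply, hL.block a f g hf hg, hL'.block a f g hf hg, mul_add,
      Finset.sum_add_distrib]

theorem Liftable.smul
    {q : (Fin n → ℝ) → ((Fin k → Fin n) → ℝ) → ((Fin k → Fin n) → ℝ) → ℝ}
    (c : ℝ) (hq : Liftable q) : Liftable fun a u v => c * q a u v := by
  obtain ⟨L, hL⟩ := hq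
  refine ⟨c • L, fun U X f g => ?_, fun a f g hf hg => ?_⟩
  · simp only [LinearMap.smul_apply, hL.conj]
  · simp only [LinearMap.smul_apply, hL.block a f g hf hg, smul_eq_mul, Finset.mul_sum]
    exact Finset.sum_congr rfl fun J _ => by ring

theorem liftable_zero :
    Liftable fun (_ : Fin n → ℝ) (_ _ : (Fin k → Fin n) → ℝ) => (0 : ℝ) :=
  ⟨0, fun U X f g => by simp, fun a f g _ _ => by simp⟩

/-- The pullback of a lift along the contraction. -/
theorem Liftable.contract
    {q : (Fin n → ℝ) → ((Fin k → Fin n) → ℝ) → ((Fin k → Fin n) → ℝ) → ℝ} (hq : Liftable q) :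
    Liftable fun a u v => q a (sumCons n k u) (sumCons n k v) := by
  obtain ⟨L, hL⟩ := hq
  let L' : SymMat n →ₗ[ℝ] TensorMat n (k + 1) →ₗ[ℝ] TensorMat n (k + 1) →ₗ[ℝ] ℝ :=
    { toFun := fun X => (L X).compl₁₂ SpectralLMI.contract SpectralLMI.contract
      map_add' := fun X Y => LinearMap.ext₂ fun f g => by simp
      map_smul' := fun c X => LinearMap.ext₂ fun f g => by simp }
  have hL' : ∀ X f g, L' X f g = L X (SpectralLMI.contract f) (SpectralLMI.contract g) :=
    fun _ _ _ => rfl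
  refine ⟨L', fun U X f g => ?_, fun a f g hf hg => ?_⟩
  · rw [hL', hL', contract_conj (orthogonal_transpose_mul U),
      contract_conj (orthogonal_transpose_mul U), hL.conj]
  · rw [hL', hL.block a _ _ hf.contract hg.contract]
    exact Finset.sum_congr rfl fun J _ => by rw [J.sumCons_comp hf, J.sumCons_comp hg]

theorem sumCons_comp_perm (π : Equiv.Perm (Fin n)) (u : (Fin (k + 1) → Fin n) → ℝ) :
    sumCons n k (fun i => u (π ∘ i)) = fun i => sumCons n k u (π ∘ i) := by
  funext i
  simp only [sumCons_apply, comp_cons]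
  exact Equiv.sum_comp π fun d => u (Fin.cons d (π ∘ i))

theorem IsInvariantLift.contract {B : TensorMat n k →ₗ[ℝ] TensorMat n k →ₗ[ℝ] ℝ}
    {q : ((Fin k → Fin n) → ℝ) → ((Fin k → Fin n) → ℝ) → ℝ} (h : IsInvariantLift B q) :
    IsInvariantLift (B.compl₁₂ contract contract)
      fun u v => q (sumCons n k u) (sumCons n k v) where
  conj U f g := by
    simp only [LinearMap.compl₁₂_apply]
    rw [contract_conj (orthogonal_transpose_mul U), contract_conj (orthogonal_transpose_mul U),
      h.conj]
  block f g hf hg := by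
    rw [LinearMap.compl₁₂_apply, h.block _ _ hf.contract hg.contract]
    exact Finset.sum_congr rfl fun J _ => by rw [J.sumCons_comp hf, J.sumCons_comp hg]
  perm π u v := by rw [sumCons_comp_perm, sumCons_comp_perm, h.perm]
  add_left u u' v := by rw [map_add, h.add_left]
  add_right u v v' := by rw [map_add, h.add_right]
  smul_left c u v := by rw [map_smul, h.smul_left]
  smul_right c u v := by rw [map_smul, h.smul_right]

theorem isInvariantLift_inner (n k : ℕ) : IsInvariantLift ((k.factorial : ℝ)⁻¹ • tensorInner n k)
    fun u v => ∑ i, u i * v i where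
  conj U f g := by
    simp only [LinearMap.smul_apply]
    rw [tensorInner_conj (orthogonal_transpose_mul U)]
  block f g hf hg := by
    rw [LinearMap.smul_apply, LinearMap.smul_apply, tensorInner_eq_sum_block hf hg, smul_eq_mul,
      inv_mul_cancel_left₀]
    exact_mod_cast k.factorial_ne_zero
  perm π u v := Equiv.sum_comp (Equiv.arrowCongr (Equiv.refl _) π) fun i => u i * v i
  add_left u u' v := by simp [add_mul, Finset.sum_add_distrib]
  add_right u v v' := by simp [mul_add, Finset.sum_add_distrib]
  smul_left c u v := by simp [Finset.mul_sum, mul_assoc]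
  smul_right c u v := by simp [Finset.mul_sum, mul_left_comm]

theorem trace_conjRep (U : Matrix.orthogonalGroup (Fin n) ℝ) (X : SymMat n) :
    (conjRep n U X).1.trace = X.1.trace := by
  rw [conjRep_coe, Matrix.trace_mul_comm, ← Matrix.mul_assoc, orthogonal_transpose_mul,
    Matrix.one_mul]

theorem IsInvariantLift.liftable_trace {B : TensorMat n k →ₗ[ℝ] TensorMat n k →ₗ[ℝ] ℝ}
    {q : ((Fin k → Fin n) → ℝ) → ((Fin k → Fin n) → ℝ) → ℝ} (h : IsInvariantLift B q) :
    Liftable fun a u v => (∑ p, a p) * q u v := by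
  let L : SymMat n →ₗ[ℝ] TensorMat n k →ₗ[ℝ] TensorMat n k →ₗ[ℝ] ℝ :=
    (Matrix.traceLinearMap (Fin n) ℝ ℝ ∘ₗ (SymMat n).subtype).smulRight B
  have hL : ∀ X f g, L X f g = X.1.trace * B f g := fun _ _ _ => rfl
  refine ⟨L, fun U X f g => ?_, fun a f g hf hg => ?_⟩
  · rw [hL, hL, h.conj, trace_conjRep]
  · rw [hL, h.block f g hf hg, Finset.mul_sum]
    refine Finset.sum_congr rfl fun J _ => ?_
    rw [show (diag a).1.trace = ∑ p, a p from Matrix.trace_diagonal a]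
    ring

/-- Multiplication of a function of tuples with the sum of the values of `a` at the tuple. -/
def mulSum (a : Fin n → ℝ) (u : (Fin k → Fin n) → ℝ) : (Fin k → Fin n) → ℝ :=
  fun i => (∑ r, a (i r)) * u i

/-- The derivation weighs the entry at (`J.left ∘ i`, `J.right ∘ i`) by half the sum of a over both
tuples. Together these contain the same labels as i and `J.swap ∘ i`. -/
theorem Block.comp_symDeriv (J : Block n) (a : Fin n → ℝ) (f : TensorMat n k) :
    J.comp (symDeriv k (diag a) f) =
      (1 / 2 : ℝ) • (mulSum a (J.comp f) + mulSum (fun p => a (J.swap p)) (J.comp f)) := by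
  funext i
  have h : (∑ r, a ((J.left ∘ i) r)) + ∑ r, a ((J.right ∘ i) r) =
      (∑ r, a (i r)) + ∑ r, a (J.swap (i r)) := by
    rw [← Finset.sum_add_distrib, ← Finset.sum_add_distrib]
    exact Finset.sum_congr rfl fun r _ => J.add_left_right a (i r)
  simp only [Block.comp_apply, Pi.smul_apply, Pi.add_apply, mulSum, symDeriv_diag, h, smul_eq_mul]
  split_ifs <;> ring

/-- Apply the invariance of q to the permutation `J.swap`. Both block components change by (-1)^|A|,
the two signs cancel, and only a is replaced by a ∘ `J.swap`. Thus the two halves in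
`Block.comp_symDeriv` contribute equally, which is why the derivation was symmetrized. -/
theorem IsInvariantLift.mulSum_swap {B : TensorMat n k →ₗ[ℝ] TensorMat n k →ₗ[ℝ] ℝ}
    {q : ((Fin k → Fin n) → ℝ) → ((Fin k → Fin n) → ℝ) → ℝ} (h : IsInvariantLift B q)
    (J : Block n) (a : Fin n → ℝ) {f g : TensorMat n k} (hf : IsAlt f) (hg : IsAlt g) :
    q (mulSum (fun p => a (J.swap p)) (J.comp f)) (J.comp g) =
        q (mulSum a (J.comp f)) (J.comp g) ∧
      q (J.comp f) (mulSum (fun p => a (J.swap p)) (J.comp g)) =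
        q (J.comp f) (mulSum a (J.comp g)) := by
  have h1 : ∀ {f : TensorMat n k}, IsAlt f → (fun i => J.comp f (J.swap ∘ i)) =
      ((-1 : ℝ) ^ J.1.1.card) • J.comp f := fun hf => funext fun i => J.comp_swap hf i
  have h2 : ∀ {f : TensorMat n k}, IsAlt f → (fun i => mulSum a (J.comp f) (J.swap ∘ i)) =
      ((-1 : ℝ) ^ J.1.1.card) • mulSum (fun p => a (J.swap p)) (J.comp f) := by
    intro f hf
    funext i
    simp only [mulSum, J.comp_swap hf, Pi.smul_apply, smul_eq_mul, Function.comp_apply]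
    ring
  have h3 : ((-1 : ℝ) ^ J.1.1.card) * (-1 : ℝ) ^ J.1.1.card = 1 := by
    rw [← mul_pow]; norm_num
  constructor
  · rw [← h.perm J.swap (mulSum a (J.comp f)), h1 hg, h2 hf, h.smul_left, h.smul_right,
      ← mul_assoc, h3, one_mul]
  · rw [← h.perm J.swap (J.comp f) (mulSum a (J.comp g)), h1 hf, h2 hg, h.smul_left, h.smul_right,
      ← mul_assoc, h3, one_mul]

theorem IsInvariantLift.liftable_mulSum_left {B : TensorMat n k →ₗ[ℝ] TensorMat n k →ₗ[ℝ] ℝ}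
    {q : ((Fin k → Fin n) → ℝ) → ((Fin k → Fin n) → ℝ) → ℝ} (h : IsInvariantLift B q) :
    Liftable fun a u v => q (mulSum a u) v := by
  let L : SymMat n →ₗ[ℝ] TensorMat n k →ₗ[ℝ] TensorMat n k →ₗ[ℝ] ℝ :=
    { toFun := fun X => B ∘ₗ symDeriv k X
      map_add' := fun X Y => by ext1 f; simp
      map_smul' := fun c X => by ext1 f; simp }
  have hL : ∀ X f g, L X f g = B (symDeriv k X f) g := fun _ _ _ => rfl
  refine ⟨L, fun U X f g => ?_, fun a f g hf hg => ?_⟩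
  · rw [hL, hL, symDeriv_conj, h.conj]
  · rw [hL, h.block _ _ (hf.symDeriv_diag a) hg]
    refine Finset.sum_congr rfl fun J _ => ?_
    rw [J.comp_symDeriv, h.smul_left, h.add_left, (h.mulSum_swap J a hf hg).1]
    ring

theorem IsInvariantLift.liftable_mulSum_right {B : TensorMat n k →ₗ[ℝ] TensorMat n k →ₗ[ℝ] ℝ}
    {q : ((Fin k → Fin n) → ℝ) → ((Fin k → Fin n) → ℝ) → ℝ} (h : IsInvariantLift B q) :
    Liftable fun a u v => q u (mulSum a v) := by
  let L : SymMat n →ₗ[ℝ] TensorMat n k →ₗ[ℝ] TensorMat n k →ₗ[ℝ] ℝ :=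
    { toFun := fun X => B.compl₂ (symDeriv k X)
      map_add' := fun X Y => LinearMap.ext₂ fun f g => by simp
      map_smul' := fun c X => LinearMap.ext₂ fun f g => by simp }
  have hL : ∀ X f g, L X f g = B f (symDeriv k X g) := fun _ _ _ => rfl
  refine ⟨L, fun U X f g => ?_, fun a f g hf hg => ?_⟩
  · rw [hL, hL, symDeriv_conj, h.conj]
  · rw [hL, h.block _ _ hf (hg.symDeriv_diag a)]
    refine Finset.sum_congr rfl fun J _ => ?_
    rw [J.comp_symDeriv, h.smul_right, h.add_right, (h.mulSum_swap J a hf hg).2]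
    ring

/-- The contraction of the first `x` indices of a function of tuples. -/
def sumConsIter (n k : ℕ) : (x : ℕ) → ((Fin (k + x) → Fin n) → ℝ) →ₗ[ℝ] ((Fin k → Fin n) → ℝ)
  | 0 => LinearMap.id
  | x + 1 => sumConsIter n k x ∘ₗ sumCons n (k + x)

theorem exists_isInvariantLift (n k x : ℕ) : ∃ B : TensorMat n (k + x) →ₗ[ℝ] _,
    IsInvariantLift B fun u v => ∑ i, sumConsIter n k x u i * sumConsIter n k x v i := by
  induction x with
  | zero => exact ⟨_, isInvariantLift_inner n k⟩
  | succ x ih =>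
    obtain ⟨B, hB⟩ := ih
    exact ⟨_, hB.contract⟩

/-- Here the derivation acts after all contractions, so the weight is the sum of a over the
uncontracted entries only. It supplies the overlap term of the kernels below. -/
theorem liftable_sumConsIter (n k x : ℕ) : Liftable fun a (u v : (Fin (k + x) → Fin n) → ℝ) =>
    ∑ i, (∑ r, a (i r)) * (sumConsIter n k x u i * sumConsIter n k x v i) := by
  induction x with
  | zero =>
    refine (isInvariantLift_inner n k).liftable_mulSum_left.congr fun a u _ v _ => ?_
    exact Finset.sum_congr rfl fun i _ => mul_assoc _ _ _
  | succ x ih => exact ih.contract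

end SpectralLMI

/-! ### Equivariant kernels on pairs of sets -/

namespace SpectralLMI

/-- The four regions of the Venn diagrams of (A, B) and (A', B') have equal sizes, and bijections
between corresponding regions glue to a permutation. Thus the overlap size classifies the orbits of
pairs of k-subsets. -/
theorem exists_perm_image_eq {α : Type*} [Fintype α] [DecidableEq α] {A B A' B' : Finset α}
    (hA : A.card = A'.card) (hB : B.card = B'.card) (hAB : (A ∩ B).card = (A' ∩ B').card) :
    ∃ π : Equiv.Perm α, A.image π = A' ∧ B.image π = B' := by
  have hc : ∀ b : Bool × Bool, Nonempty ({p // (decide (p ∈ A), decide (p ∈ B)) = b} ≃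
      {p // (decide (p ∈ A'), decide (p ∈ B')) = b}) := by
    intro b
    refine ⟨Fintype.equivOfCardEq ?_⟩
    rw [Fintype.card_subtype, Fintype.card_subtype]
    have h1 := Finset.card_sdiff_add_card_inter A B
    have h1' := Finset.card_sdiff_add_card_inter A' B'
    have h2 := Finset.card_sdiff_add_card_inter B A
    have h2' := Finset.card_sdiff_add_card_inter B' A'
    have h3 := Finset.card_compl_add_card (A ∪ B)
    have h3' := Finset.card_compl_add_card (A' ∪ B')
    have h4 := Finset.card_union_add_card_inter A B
    have h4' := Finset.card_union_add_card_inter A' B'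
    rw [Finset.inter_comm] at h2 h2'
    have hf : ∀ C D : Finset α,
        (Finset.univ.filter fun p => (decide (p ∈ C), decide (p ∈ D)) = b) =
          if b.1 then (if b.2 then C ∩ D else C \ D) else (if b.2 then D \ C else (C ∪ D)ᶜ) := by
      intro C D
      ext p
      obtain ⟨b₁, b₂⟩ := b
      cases b₁ <;> cases b₂ <;> simp [and_comm]
    rw [hf, hf]
    split_ifs <;> omega
  let e := fun b => (hc b).some
  let π : Equiv.Perm α := (Equiv.sigmaFiberEquiv fun p => (decide (p ∈ A), decide (p ∈ B))).symm.trans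
    ((Equiv.sigmaCongrRight e).trans
      (Equiv.sigmaFiberEquiv fun p => (decide (p ∈ A'), decide (p ∈ B'))))
  have hπ : ∀ p, (decide (π p ∈ A'), decide (π p ∈ B')) = (decide (p ∈ A), decide (p ∈ B)) :=
    fun p => (e _ ⟨p, rfl⟩).2
  have hπA : ∀ p, π p ∈ A' ↔ p ∈ A := fun p => by
    simpa using congrArg Prod.fst (hπ p)
  have hπB : ∀ p, π p ∈ B' ↔ p ∈ B := fun p => by
    simpa using congrArg Prod.snd (hπ p)
  refine ⟨π, ?_, ?_⟩
  · ext p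
    rw [Finset.mem_image]
    refine ⟨?_, fun hp => ⟨π.symm p, ?_, π.apply_symm_apply p⟩⟩
    · rintro ⟨q, hq, rfl⟩
      exact (hπA q).2 hq
    · rw [← hπA, π.apply_symm_apply]; exact hp
  · ext p
    rw [Finset.mem_image]
    refine ⟨?_, fun hp => ⟨π.symm p, ?_, π.apply_symm_apply p⟩⟩
    · rintro ⟨q, hq, rfl⟩
      exact (hπB q).2 hq
    · rw [← hπB, π.apply_symm_apply]; exact hp

section Overlap
variable {n k : ℕ}

/-- The set of common entries of two tuples. -/
def overlap (i j : Fin k → Fin n) : Finset (Fin n) :=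
  Finset.univ.image i ∩ Finset.univ.image j

theorem exists_perm_of_card_overlap_eq {i j i₀ j₀ : Fin k → Fin n} (hi : Function.Injective i)
    (hj : Function.Injective j) (hi₀ : Function.Injective i₀) (hj₀ : Function.Injective j₀)
    (h : (overlap i j).card = (overlap i₀ j₀).card) :
    ∃ (π : Equiv.Perm (Fin n)) (σ τ : Equiv.Perm (Fin k)), i = (π ∘ i₀) ∘ σ ∧ j = (π ∘ j₀) ∘ τ := by
  obtain ⟨π, h1, h2⟩ := exists_perm_image_eq (A := Finset.univ.image i₀) (A' := Finset.univ.image i)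
    (B := Finset.univ.image j₀) (B' := Finset.univ.image j)
    (by rw [Finset.card_image_of_injective _ hi, Finset.card_image_of_injective _ hi₀])
    (by rw [Finset.card_image_of_injective _ hj, Finset.card_image_of_injective _ hj₀]) h.symm
  rw [Finset.image_image] at h1 h2
  obtain ⟨σ, hσ⟩ := exists_perm_of_image_eq hi h1.symm
  obtain ⟨τ, hτ⟩ := exists_perm_of_image_eq hj h2.symm
  exact ⟨π, σ, τ, hσ, hτ⟩

theorem overlap_comp_perm (i j : Fin k → Fin n) (σ τ : Equiv.Perm (Fin k)) :
    overlap (i ∘ σ) (j ∘ τ) = overlap i j := by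
  rw [overlap, image_comp_perm, image_comp_perm, overlap]

end Overlap

/-- An equivariant family of kernels on tuples that depends linearly on a vector. -/
structure IsEquivariantKernel {n k : ℕ}
    (κ : (Fin n → ℝ) → (Fin k → Fin n) → (Fin k → Fin n) → ℝ) : Prop where
  add : ∀ a b i j, κ (a + b) i j = κ a i j + κ b i j
  smul : ∀ (c : ℝ) a i j, κ (c • a) i j = c * κ a i j
  perm : ∀ (π : Equiv.Perm (Fin n)) a i j, κ a (π ∘ i) (π ∘ j) = κ (a ∘ π) i j

/-- An equivariant family of kernels on sets, viewed as kernels on tuples. -/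
structure IsSetKernel {n k : ℕ}
    (κ : (Fin n → ℝ) → (Fin k → Fin n) → (Fin k → Fin n) → ℝ) : Prop
    extends IsEquivariantKernel κ where
  left : ∀ a (σ : Equiv.Perm (Fin k)) i j, κ a (i ∘ σ) j = κ a i j
  right : ∀ a (σ : Equiv.Perm (Fin k)) i j, κ a i (j ∘ σ) = κ a i j
  zero_left : ∀ a i j, ¬ Function.Injective i → κ a i j = 0
  zero_right : ∀ a i j, ¬ Function.Injective j → κ a i j = 0

section Kernel
variable {n k : ℕ} {κ : (Fin n → ℝ) → (Fin k → Fin n) → (Fin k → Fin n) → ℝ}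

theorem IsEquivariantKernel.eq_sum (h : IsEquivariantKernel κ) (a : Fin n → ℝ)
    (i j : Fin k → Fin n) : κ a i j = ∑ p, a p * κ (Pi.single p 1) i j := by
  let l : (Fin n → ℝ) →ₗ[ℝ] ℝ :=
    { toFun := fun a => κ a i j
      map_add' := fun a b => h.add a b i j
      map_smul' := fun c a => h.smul c a i j }
  have := LinearMap.pi_apply_eq_sum_univ l a
  simp only [smul_eq_mul] at this
  refine this.trans (Finset.sum_congr rfl fun p _ => ?_)
  congr 1
  change κ _ i j = _
  congr 1
  funext q
  simp [Pi.single_apply, eq_comm]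

/-- The transposition of p and q stabilizes both underlying sets, so it only reorders the two
tuples, and the kernel does not see the order. -/
theorem IsSetKernel.comp_swap_eq (h : IsSetKernel κ) {i j : Fin k → Fin n}
    (hi : Function.Injective i) (hj : Function.Injective j) {p q : Fin n}
    (hpi : p ∈ Finset.univ.image i ↔ q ∈ Finset.univ.image i)
    (hpj : p ∈ Finset.univ.image j ↔ q ∈ Finset.univ.image j) :
    κ (Pi.single p 1) i j = κ (Pi.single q 1) i j := by
  have h1 : ∀ {i : Fin k → Fin n}, Function.Injective i →
      (p ∈ Finset.univ.image i ↔ q ∈ Finset.univ.image i) →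
      ∃ σ : Equiv.Perm (Fin k), Equiv.swap p q ∘ i = i ∘ σ := by
    intro i hi hpq
    refine exists_perm_of_image_eq ((Equiv.swap p q).injective.comp hi) ?_
    rw [← Finset.image_image]
    apply Finset.eq_of_subset_of_card_le
    · intro x hx
      obtain ⟨y, hy, rfl⟩ := Finset.mem_image.1 hx
      rw [Equiv.swap_apply_def]
      split_ifs with h2 h3
      · exact hpq.1 (h2 ▸ hy)
      · exact hpq.2 (h3 ▸ hy)
      · exact hy
    · rw [Finset.card_image_of_injective _ (Equiv.swap p q).injective]
  obtain ⟨σ, hσ⟩ := h1 hi hpi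
  obtain ⟨τ, hτ⟩ := h1 hj hpj
  have h2 := h.perm (Equiv.swap p q) (Pi.single p 1) i j
  rw [hσ, hτ, h.left, h.right] at h2
  rw [h2]
  congr 1
  funext x
  simp only [Function.comp_apply, Pi.single_apply]
  congr 1
  rw [eq_iff_iff]
  exact Equiv.swap_apply_eq_iff.trans (by rw [Equiv.swap_apply_left])

/-- The values of an equivariant kernel at one pair of sets. -/
theorem IsSetKernel.exists_coeff (h : IsSetKernel κ) {i j : Fin k → Fin n}
    (hi : Function.Injective i) (hj : Function.Injective j) : ∃ c₁ c₂ c₃ c₄ : ℝ, ∀ a,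
      κ a i j = c₁ * ∑ p, a p + c₂ * ∑ r, a (i r) + c₃ * ∑ r, a (j r) +
        c₄ * ∑ p ∈ overlap i j, a p := by
  let A := Finset.univ.image i
  let B := Finset.univ.image j
  have hT : ∀ b₁ b₂ : Prop, ∃ t : ℝ, ∀ p, (p ∈ A ↔ b₁) → (p ∈ B ↔ b₂) →
      κ (Pi.single p 1) i j = t := by
    intro b₁ b₂
    by_cases hp : ∃ p, (p ∈ A ↔ b₁) ∧ (p ∈ B ↔ b₂)
    · obtain ⟨p, hp1, hp2⟩ := hp
      exact ⟨κ (Pi.single p 1) i j, fun q hq1 hq2 =>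
        h.comp_swap_eq hi hj (hq1.trans hp1.symm) (hq2.trans hp2.symm)⟩
    · exact ⟨0, fun q hq1 hq2 => absurd ⟨q, hq1, hq2⟩ hp⟩
  obtain ⟨t₀₀, h₀₀⟩ := hT False False
  obtain ⟨t₁₀, h₁₀⟩ := hT True False
  obtain ⟨t₀₁, h₀₁⟩ := hT False True
  obtain ⟨t₁₁, h₁₁⟩ := hT True True
  -- By linearity in a only four values matter, one per region of the Venn diagram. The coefficients
  -- come from inclusion and exclusion, expressing these values through the indicators of
  -- everything, of each set and of their intersection.
  refine ⟨t₀₀, t₁₀ - t₀₀, t₀₁ - t₀₀, t₁₁ - t₁₀ - t₀₁ + t₀₀, fun a => ?_⟩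
  have hs : ∀ {i : Fin k → Fin n}, Function.Injective i → ∑ r, a (i r) =
      ∑ p, if p ∈ Finset.univ.image i then a p else 0 := by
    intro i hi
    rw [← Finset.sum_filter, Finset.filter_mem_eq_inter, Finset.univ_inter,
      Finset.sum_image fun r _ s _ h => hi h]
  have ho : ∑ p ∈ overlap i j, a p = ∑ p, if p ∈ overlap i j then a p else 0 := by
    rw [← Finset.sum_filter, Finset.filter_mem_eq_inter, Finset.univ_inter]
  rw [h.eq_sum, hs hi, hs hj, ho]
  simp only [Finset.mul_sum, ← Finset.sum_add_distrib]
  refine Finset.sum_congr rfl fun p _ => ?_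
  simp only [overlap, Finset.mem_inter]
  by_cases hp1 : p ∈ Finset.univ.image i <;> by_cases hp2 : p ∈ Finset.univ.image j
  · rw [h₁₁ p (iff_true_intro hp1) (iff_true_intro hp2)]
    simp only [hp1, hp2, and_self, if_true]; ring
  · rw [h₁₀ p (iff_true_intro hp1) (iff_false_intro hp2)]
    simp only [hp1, hp2, and_false, if_true, if_false]; ring
  · rw [h₀₁ p (iff_false_intro hp1) (iff_true_intro hp2)]
    simp only [hp1, hp2, and_true, if_true, if_false]; ring
  · rw [h₀₀ p (iff_false_intro hp1) (iff_false_intro hp2)]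
    simp only [hp1, hp2, and_false, if_false]; ring

/-- The symmetrization of a kernel on tuples to a kernel on sets. -/
noncomputable def symKernel (κ : (Fin n → ℝ) → (Fin k → Fin n) → (Fin k → Fin n) → ℝ) :
    (Fin n → ℝ) → (Fin k → Fin n) → (Fin k → Fin n) → ℝ := fun a i j =>
  open Classical in
  if Function.Injective i ∧ Function.Injective j then
    ∑ σ : Equiv.Perm (Fin k), ∑ τ : Equiv.Perm (Fin k), κ a (i ∘ σ) (j ∘ τ) else 0

theorem symKernel_of_injective (a : Fin n → ℝ) {i j : Fin k → Fin n} (hi : Function.Injective i)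
    (hj : Function.Injective j) : symKernel κ a i j =
      ∑ σ : Equiv.Perm (Fin k), ∑ τ : Equiv.Perm (Fin k), κ a (i ∘ σ) (j ∘ τ) :=
  if_pos ⟨hi, hj⟩

theorem IsEquivariantKernel.symKernel (h : IsEquivariantKernel κ) :
    IsSetKernel (symKernel κ) where
  add a b i j := by
    simp only [SpectralLMI.symKernel, h.add, Finset.sum_add_distrib]
    split_ifs <;> simp
  smul c a i j := by
    simp only [SpectralLMI.symKernel, h.smul, Finset.mul_sum, mul_ite, mul_zero]
  perm π a i j := by
    simp only [SpectralLMI.symKernel, Function.comp_assoc, h.perm, π.injective.of_comp_iff]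
  left a σ i j := by
    simp only [SpectralLMI.symKernel, Equiv.injective_comp]
    congr 1
    exact Equiv.sum_comp (Equiv.mulLeft σ) fun σ' => ∑ τ : Equiv.Perm (Fin k), κ a (i ∘ σ') (j ∘ τ)
  right a σ i j := by
    simp only [SpectralLMI.symKernel, Equiv.injective_comp]
    congr 1
    refine Finset.sum_congr rfl fun σ' _ => ?_
    exact Equiv.sum_comp (Equiv.mulLeft σ) fun τ => κ a (i ∘ σ') (j ∘ τ)
  zero_left a i j hi := if_neg fun h => hi h.1
  zero_right a i j hj := if_neg fun h => hj h.2

/-- The bilinear form on functions of tuples given by a kernel. -/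
def kernelForm (κ : (Fin n → ℝ) → (Fin k → Fin n) → (Fin k → Fin n) → ℝ) (a : Fin n → ℝ)
    (u v : (Fin k → Fin n) → ℝ) : ℝ := ∑ i, ∑ j, κ a i j * (u i * v j)

/-- Reindexing each of the (k!)² summands by its pair of reorderings gives the original form. The
cutoff to injective tuples loses nothing, because u and v vanish on the others. -/
theorem kernelForm_symKernel (a : Fin n → ℝ) {u v : (Fin k → Fin n) → ℝ} (hu : u ∈ setFun n k)
    (hv : v ∈ setFun n k) : kernelForm (symKernel κ) a u v =
      ((k.factorial : ℝ) * k.factorial) * kernelForm κ a u v := by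
  have h1 : ∀ i j, symKernel κ a i j * (u i * v j) =
      ∑ σ : Equiv.Perm (Fin k), ∑ τ : Equiv.Perm (Fin k),
        κ a (i ∘ σ) (j ∘ τ) * (u (i ∘ σ) * v (j ∘ τ)) := by
    intro i j
    simp only [hu.1, hv.1, ← Finset.sum_mul]
    by_cases hi : Function.Injective i
    · by_cases hj : Function.Injective j
      · rw [symKernel_of_injective a hi hj]
      · simp [hv.2 j hj]
    · simp [hu.2 i hi]
  have h2 : ∀ (σ : Equiv.Perm (Fin k)) (F : (Fin k → Fin n) → ℝ), ∑ i, F (i ∘ σ) = ∑ i, F i :=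
    fun σ F => Equiv.sum_comp (Equiv.arrowCongr σ.symm (Equiv.refl (Fin n))) F
  simp only [kernelForm, h1]
  calc ∑ i, ∑ j, ∑ σ : Equiv.Perm (Fin k), ∑ τ : Equiv.Perm (Fin k),
        κ a (i ∘ σ) (j ∘ τ) * (u (i ∘ σ) * v (j ∘ τ))
      = ∑ σ : Equiv.Perm (Fin k), ∑ τ : Equiv.Perm (Fin k), ∑ i, ∑ j,
        κ a (i ∘ σ) (j ∘ τ) * (u (i ∘ σ) * v (j ∘ τ)) := by
        rw [Finset.sum_congr rfl fun i _ => Finset.sum_comm, Finset.sum_comm]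
        refine Finset.sum_congr rfl fun σ _ => ?_
        rw [Finset.sum_congr rfl fun i _ => Finset.sum_comm, Finset.sum_comm]
    _ = ∑ σ : Equiv.Perm (Fin k), ∑ τ : Equiv.Perm (Fin k), ∑ i, ∑ j, κ a i j * (u i * v j) := by
        refine Finset.sum_congr rfl fun σ _ => Finset.sum_congr rfl fun τ _ => ?_
        rw [h2 σ fun i => ∑ j, κ a i (j ∘ τ) * (u i * v (j ∘ τ))]
        exact Finset.sum_congr rfl fun i _ => h2 τ fun j => κ a i j * (u i * v j)
    _ = _ := by
        simp [Fintype.card_perm, mul_assoc]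

end Kernel
end SpectralLMI

/-! ### Generators of the equivariant kernels -/

namespace SpectralLMI
variable {n k : ℕ}

/-- The last `k` entries of a tuple. -/
def lastPart (k x : ℕ) (i : Fin (k + x) → Fin n) : Fin k → Fin n := fun r => i (Fin.addNat r x)

theorem sumConsIter_apply (k x : ℕ) (u : (Fin (k + x) → Fin n) → ℝ) (C : Fin k → Fin n) :
    sumConsIter n k x u C = ∑ i, if lastPart k x i = C then u i else 0 := by
  induction x with
  | zero =>
    have h : ∀ i : Fin (k + 0) → Fin n, lastPart k 0 i = i := fun _ => rfl
    simp only [h]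
    exact (Finset.sum_ite_eq' Finset.univ C u).symm ▸ (if_pos (Finset.mem_univ C)).symm
  | succ x ih =>
    have h1 : sumConsIter n k (x + 1) u C = sumConsIter n k x (sumCons n (k + x) u) C := rfl
    have h2 : ∀ d (i : Fin (k + x) → Fin n),
        lastPart k (x + 1) (Fin.cons d i : Fin (k + x + 1) → Fin n) = lastPart k x i :=
      fun d i => rfl
    have h3 := sum_cons (n := n) (k := k + x)
      fun i => if lastPart k (x + 1) i = C then u i else 0
    rw [h1, ih]
    refine Eq.trans ?_ h3.symm
    rw [Finset.sum_comm]
    refine Finset.sum_congr rfl fun i _ => ?_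
    simp only [h2, sumCons_apply]
    split_ifs <;> simp

theorem sum_mul_sumConsIter (k x : ℕ) (F : (Fin k → Fin n) → ℝ)
    (u v : (Fin (k + x) → Fin n) → ℝ) :
    ∑ C, F C * (sumConsIter n k x u C * sumConsIter n k x v C) =
      ∑ i, ∑ j, (if lastPart k x i = lastPart k x j then F (lastPart k x i) else 0) *
        (u i * v j) := by
  simp only [sumConsIter_apply, Finset.sum_mul_sum]
  simp only [Finset.mul_sum]
  rw [Finset.sum_comm]
  refine Finset.sum_congr rfl fun i _ => ?_
  rw [Finset.sum_comm]
  refine Finset.sum_congr rfl fun j _ => ?_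
  rw [Finset.sum_eq_single (lastPart k x i)]
  · rw [if_pos rfl]
    by_cases h : lastPart k x i = lastPart k x j
    · rw [if_pos h, if_pos h.symm]
    · rw [if_neg h, if_neg (Ne.symm h)]; ring
  · intro C _ hC
    rw [if_neg (Ne.symm hC)]; ring
  · simp

/-- The kernels that generate all equivariant kernels on sets by symmetrization. -/
def genKernel (n k x : ℕ) (c₁ c₂ c₃ c₄ : ℝ) (a : Fin n → ℝ) (i j : Fin (k + x) → Fin n) : ℝ :=
  if lastPart k x i = lastPart k x j then
    c₁ * ∑ p, a p + c₂ * ∑ r, a (i r) + c₃ * ∑ r, a (j r) + c₄ * ∑ r, a (lastPart k x i r) else 0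

theorem isEquivariantKernel_genKernel (n k x : ℕ) (c₁ c₂ c₃ c₄ : ℝ) :
    IsEquivariantKernel (genKernel n k x c₁ c₂ c₃ c₄) where
  add a b i j := by
    simp only [genKernel, Pi.add_apply, Finset.sum_add_distrib]
    split_ifs <;> ring
  smul c a i j := by
    simp only [genKernel, Pi.smul_apply, smul_eq_mul, ← Finset.mul_sum]
    split_ifs <;> ring
  perm π a i j := by
    have h : ∀ i : Fin (k + x) → Fin n, lastPart k x (π ∘ i) = π ∘ lastPart k x i := fun _ => rfl
    have h2 : ∑ p, a p = ∑ p, a (π p) := (Equiv.sum_comp π a).symm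
    simp only [genKernel, h, π.injective.comp_left.eq_iff, Function.comp_apply, h2]

/-- The agreement of the last k entries is the kernel of x contractions followed by the inner
product. The four terms insert, respectively, the trace, a derivation on the left or on the right
before the contractions, and a derivation after them. -/
theorem liftable_genKernel (n k x : ℕ) (c₁ c₂ c₃ c₄ : ℝ) :
    Liftable (kernelForm (genKernel n k x c₁ c₂ c₃ c₄)) := by
  obtain ⟨B, hB⟩ := exists_isInvariantLift n k x
  refine (((hB.liftable_trace.smul c₁).add (hB.liftable_mulSum_left.smul c₂)).add
    ((hB.liftable_mulSum_right.smul c₃).add ((liftable_sumConsIter n k x).smul c₄))).congr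
    fun a u _ v _ => ?_
  have h := sum_mul_sumConsIter (n := n) k x fun _ => 1
  simp only [one_mul] at h
  simp only [h, sum_mul_sumConsIter, kernelForm, Finset.mul_sum, ← Finset.sum_add_distrib]
  refine Finset.sum_congr rfl fun i _ => Finset.sum_congr rfl fun j _ => ?_
  simp only [genKernel, mulSum]
  split_ifs <;> ring

theorem lastPart_injective (k x : ℕ) {i : Fin (k + x) → Fin n} (hi : Function.Injective i) :
    Function.Injective (lastPart k x i) := fun r s h => by
  simpa using hi h

theorem image_lastPart_subset (k x : ℕ) (i : Fin (k + x) → Fin n) :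
    Finset.univ.image (lastPart k x i) ⊆ Finset.univ.image i := by
  intro p hp
  obtain ⟨r, -, rfl⟩ := Finset.mem_image.1 hp
  exact Finset.mem_image_of_mem _ (Finset.mem_univ _)

theorem image_lastPart_subset_overlap (k x : ℕ) {i j : Fin (k + x) → Fin n}
    (h : lastPart k x i = lastPart k x j) :
    Finset.univ.image (lastPart k x i) ⊆ overlap i j :=
  Finset.subset_inter (image_lastPart_subset k x i) (h ▸ image_lastPart_subset k x j)

theorem le_card_overlap (k x : ℕ) {i j : Fin (k + x) → Fin n} (hi : Function.Injective i)
    (h : lastPart k x i = lastPart k x j) : k ≤ (overlap i j).card := by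
  have := Finset.card_le_card (image_lastPart_subset_overlap k x h)
  rwa [Finset.card_image_of_injective _ (lastPart_injective k x hi), Finset.card_univ,
    Fintype.card_fin] at this

theorem image_lastPart (k x : ℕ) {i j : Fin (k + x) → Fin n} (hi : Function.Injective i)
    (h : lastPart k x i = lastPart k x j) (hk : (overlap i j).card = k) :
    Finset.univ.image (lastPart k x i) = overlap i j := by
  refine Finset.eq_of_subset_of_card_le (image_lastPart_subset_overlap k x h) ?_
  rw [hk, Finset.card_image_of_injective _ (lastPart_injective k x hi), Finset.card_univ,
    Fintype.card_fin]

/-- The number of pairs of orderings of two sets that agree in the last `k` entries. -/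
noncomputable def agreeCount (k x : ℕ) (i j : Fin (k + x) → Fin n) : ℕ :=
  (Finset.univ.filter fun s : Equiv.Perm (Fin (k + x)) × Equiv.Perm (Fin (k + x)) =>
    lastPart k x (i ∘ s.1) = lastPart k x (j ∘ s.2)).card

theorem symKernel_genKernel_of_lt (k x : ℕ) (c₁ c₂ c₃ c₄ : ℝ) (a : Fin n → ℝ)
    {i j : Fin (k + x) → Fin n} (h : (overlap i j).card < k) :
    symKernel (genKernel n k x c₁ c₂ c₃ c₄) a i j = 0 := by
  rw [symKernel]
  split_ifs with hij
  · refine Finset.sum_eq_zero fun σ _ => Finset.sum_eq_zero fun τ _ => if_neg fun h1 => ?_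
    have := le_card_overlap k x (hij.1.comp σ.injective) h1
    rw [overlap_comp_perm] at this
    omega
  · rfl

/-- The common last part always lies in the overlap; here it has the same size and therefore
exhausts it. All nonzero summands thus coincide, and `agreeCount` counts them. -/
theorem symKernel_genKernel_of_eq (k x : ℕ) (c₁ c₂ c₃ c₄ : ℝ) (a : Fin n → ℝ)
    {i j : Fin (k + x) → Fin n} (hi : Function.Injective i) (hj : Function.Injective j)
    (h : (overlap i j).card = k) :
    symKernel (genKernel n k x c₁ c₂ c₃ c₄) a i j = agreeCount k x i j *
      (c₁ * ∑ p, a p + c₂ * ∑ r, a (i r) + c₃ * ∑ r, a (j r) + c₄ * ∑ p ∈ overlap i j, a p) := by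
  rw [symKernel_of_injective a hi hj, ← Fintype.sum_prod_type', agreeCount, ← nsmul_eq_mul,
    ← Finset.sum_const, Finset.sum_filter]
  refine Finset.sum_congr rfl fun s _ => ?_
  rw [genKernel]
  split_ifs with h1
  · rw [← overlap_comp_perm i j s.1 s.2,
      ← image_lastPart k x (hi.comp s.1.injective) h1 (by rw [overlap_comp_perm, h]),
      Finset.sum_image fun r _ s _ h =>
        lastPart_injective k x (hi.comp (Equiv.injective _)) h]
    simp only [Function.comp_apply, Equiv.sum_comp s.1 fun r => a (i r),
      Equiv.sum_comp s.2 fun r => a (j r)]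
  · rfl

theorem agreeCount_comp (k x : ℕ) (i j : Fin (k + x) → Fin n) (π : Equiv.Perm (Fin n))
    (σ τ : Equiv.Perm (Fin (k + x))) :
    agreeCount k x ((π ∘ i) ∘ σ) ((π ∘ j) ∘ τ) = agreeCount k x i j := by
  refine Finset.card_equiv ((Equiv.mulLeft σ).prodCongr (Equiv.mulLeft τ)) fun s => ?_
  have h : ∀ i : Fin (k + x) → Fin n, lastPart k x (π ∘ i) = π ∘ lastPart k x i := fun _ => rfl
  simp only [Finset.mem_filter, Finset.mem_univ, true_and, Function.comp_assoc, h,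
    π.injective.comp_left.eq_iff]
  rfl

/-- Both tuples can be reordered so that their last k entries list the overlap in one fixed order.
Positivity allows division by this count. -/
theorem agreeCount_pos (k x : ℕ) {i j : Fin (k + x) → Fin n} (hi : Function.Injective i)
    (hj : Function.Injective j) (h : (overlap i j).card = k) : 0 < agreeCount k x i j := by
  have key : ∀ {i : Fin (k + x) → Fin n}, Function.Injective i →
      ∀ c : Fin k → Fin n, Function.Injective c → (∀ r, c r ∈ Finset.univ.image i) →
      ∃ σ : Equiv.Perm (Fin (k + x)), lastPart k x (i ∘ σ) = c := by
    intro i hi c hc hci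
    have h1 : ∀ r, ∃ s, i s = c r := fun r => by simpa using hci r
    choose t ht using h1
    have hti : Function.Injective t := fun r s hrs => hc (by rw [← ht, ← ht, hrs])
    obtain ⟨σ, hσ⟩ := Equiv.Perm.exists_extending_pair (fun r : Fin k => Fin.addNat r x) t
      (fun r s h => by simpa using h) hti
    exact ⟨σ, funext fun r => by
      change i (σ (Fin.addNat r x)) = c r
      rw [hσ, ht]⟩
  let c : Fin k → Fin n := (overlap i j).orderEmbOfFin h
  have hc : Function.Injective c := ((overlap i j).orderEmbOfFin h).injective
  have hc' : ∀ r, c r ∈ overlap i j := Finset.orderEmbOfFin_mem _ h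
  obtain ⟨σ, hσ⟩ := key hi c hc fun r => (Finset.mem_inter.1 (hc' r)).1
  obtain ⟨τ, hτ⟩ := key hj c hc fun r => (Finset.mem_inter.1 (hc' r)).2
  exact Finset.card_pos.2 ⟨(σ, τ), by simp [hσ, hτ]⟩

theorem sum_comp_perm_overlap (a : Fin n → ℝ) (π : Equiv.Perm (Fin n)) (i j : Fin k → Fin n)
    (σ τ : Equiv.Perm (Fin k)) :
    ∑ p ∈ overlap ((π ∘ i) ∘ σ) ((π ∘ j) ∘ τ), a p = ∑ p ∈ overlap i j, a (π p) := by
  rw [overlap_comp_perm, overlap, ← Finset.image_image, ← Finset.image_image,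
    ← Finset.image_inter _ _ π.injective, Finset.sum_image fun p _ q _ h => π.injective h, overlap]

theorem IsSetKernel.sub {κ κ' : (Fin n → ℝ) → (Fin k → Fin n) → (Fin k → Fin n) → ℝ}
    (h : IsSetKernel κ) (h' : IsSetKernel κ') (c : ℝ) :
    IsSetKernel fun a i j => κ a i j - c * κ' a i j where
  add a b i j := by rw [h.add, h'.add]; ring
  smul c a i j := by rw [h.smul, h'.smul]; ring
  perm π a i j := by rw [h.perm, h'.perm]
  left a σ i j := by rw [h.left, h'.left]
  right a σ i j := by rw [h.right, h'.right]
  zero_left a i j hi := by rw [h.zero_left a i j hi, h'.zero_left a i j hi]; ring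
  zero_right a i j hj := by rw [h.zero_right a i j hj, h'.zero_right a i j hj]; ring

/-- Every equivariant family of kernels on sets lifts to tensors. -/
theorem IsSetKernel.liftable {h : ℕ}
    {κ : (Fin n → ℝ) → (Fin h → Fin n) → (Fin h → Fin n) → ℝ} (hκ : IsSetKernel κ) :
    Liftable (kernelForm κ) := by
  -- Induction on the least overlap size k at which the kernel may be nonzero, upwards to h + 1,
  -- where it vanishes because an overlap has at most h elements.
  suffices H : ∀ d k, h + 1 = k + d →
      ∀ κ : (Fin n → ℝ) → (Fin h → Fin n) → (Fin h → Fin n) → ℝ, IsSetKernel κ →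
      (∀ a i j, (overlap i j).card < k → κ a i j = 0) → Liftable (kernelForm κ) from
    H (h + 1) 0 (by omega) κ hκ fun a i j hij => absurd hij (Nat.not_lt_zero _)
  intro d
  induction d with
  | zero =>
    intro k hk κ _ h0
    refine liftable_zero.congr fun a u _ v _ => ?_
    rw [kernelForm]
    refine (Finset.sum_eq_zero fun i _ => Finset.sum_eq_zero fun j _ => ?_).symm
    rw [h0 a i j, zero_mul]
    have h1 := Finset.card_le_card (Finset.inter_subset_left (s₁ := Finset.univ.image i)
      (s₂ := Finset.univ.image j))
    have h2 := Finset.card_image_le (s := Finset.univ) (f := i)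
    rw [Finset.card_univ, Fintype.card_fin] at h2
    rw [overlap]
    omega
  | succ d ih =>
    intro k hk κ hκ h0
    obtain ⟨x, rfl⟩ : ∃ x, h = k + x := ⟨d, by omega⟩
    by_cases hex : ∃ i j : Fin (k + x) → Fin n, Function.Injective i ∧ Function.Injective j ∧
        (overlap i j).card = k
    · obtain ⟨i₀, j₀, hi₀, hj₀, hij₀⟩ := hex
      obtain ⟨c₁, c₂, c₃, c₄, hc⟩ := hκ.exists_coeff hi₀ hj₀
      have hN : (agreeCount k x i₀ j₀ : ℝ) ≠ 0 :=
        Nat.cast_ne_zero.2 (agreeCount_pos k x hi₀ hj₀ hij₀).ne'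
      -- The subtracted generator vanishes for overlaps smaller than k and matches κ at one pair
      -- with overlap k. Since such pairs form a single orbit up to reordering, it matches at all of
      -- them.
      have hκ' := hκ.sub (isEquivariantKernel_genKernel n k x c₁ c₂ c₃ c₄).symKernel
        (agreeCount k x i₀ j₀ : ℝ)⁻¹
      have hl := ih (k + 1) (by omega) _ hκ' ?_
      · refine (hl.add ((liftable_genKernel n k x c₁ c₂ c₃ c₄).smul
          ((agreeCount k x i₀ j₀ : ℝ)⁻¹ * (((k + x).factorial : ℝ) * (k + x).factorial)))).congr
          fun a u hu v hv => ?_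
        rw [mul_assoc, ← kernelForm_symKernel a hu hv]
        simp only [kernelForm, Finset.mul_sum, ← Finset.sum_add_distrib]
        exact Finset.sum_congr rfl fun i _ => Finset.sum_congr rfl fun j _ => by ring
      · intro a i j hij
        by_cases hi : Function.Injective i
        swap
        · exact hκ'.zero_left a i j hi
        by_cases hj : Function.Injective j
        swap
        · exact hκ'.zero_right a i j hj
        rcases Nat.lt_succ_iff_lt_or_eq.1 hij with hlt | heq
        · rw [h0 a i j hlt, symKernel_genKernel_of_lt k x _ _ _ _ a hlt]; ring
        · obtain ⟨π, σ, τ, rfl, rfl⟩ :=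
            exists_perm_of_card_overlap_eq hi hj hi₀ hj₀ (heq.trans hij₀.symm)
          rw [symKernel_genKernel_of_eq k x _ _ _ _ a hi hj heq, agreeCount_comp,
            inv_mul_cancel_left₀ hN, hκ.left, hκ.right, hκ.perm, hc, sum_comp_perm_overlap]
          simp only [Function.comp_apply, Equiv.sum_comp π a,
            Equiv.sum_comp σ fun r => a (π (i₀ r)), Equiv.sum_comp τ fun r => a (π (j₀ r))]
          ring
    · refine ih (k + 1) (by omega) κ hκ fun a i j hij => ?_
      by_cases hi : Function.Injective i
      swap
      · exact hκ.zero_left a i j hi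
      by_cases hj : Function.Injective j
      swap
      · exact hκ.zero_right a i j hj
      rcases Nat.lt_succ_iff_lt_or_eq.1 hij with hlt | heq
      · exact h0 a i j hlt
      · exact absurd ⟨i, j, hi, hj, heq⟩ hex

end SpectralLMI

/-! ### Symmetric tensors as bilinear forms on the dual space -/

namespace SpectralLMI

section Pairing
variable {V W : Type*} [AddCommGroup V] [Module ℝ V] [AddCommGroup W] [Module ℝ W]

/-- The bilinear form on the dual space given by a tensor. -/
noncomputable def pairing (V : Type*) [AddCommGroup V] [Module ℝ V] :
    V ⊗[ℝ] V →ₗ[ℝ] Module.Dual ℝ V →ₗ[ℝ] Module.Dual ℝ V →ₗ[ℝ] ℝ where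
  toFun t := LinearMap.mk₂ ℝ (fun F G => TensorProduct.dualDistrib ℝ V V (F ⊗ₜ[ℝ] G) t)
    (fun F F' G => by rw [TensorProduct.add_tmul, map_add, LinearMap.add_apply])
    (fun c F G => by rw [← TensorProduct.smul_tmul', map_smul, LinearMap.smul_apply])
    (fun F G G' => by rw [TensorProduct.tmul_add, map_add, LinearMap.add_apply])
    (fun c F G => by rw [TensorProduct.tmul_smul, map_smul, LinearMap.smul_apply])
  map_add' t t' := LinearMap.ext₂ fun F G => by simp
  map_smul' c t := LinearMap.ext₂ fun F G => by simp

theorem pairing_apply (t : V ⊗[ℝ] V) (F G : Module.Dual ℝ V) :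
    pairing V t F G = TensorProduct.dualDistrib ℝ V V (F ⊗ₜ[ℝ] G) t := rfl

theorem pairing_tmul (x y : V) (F G : Module.Dual ℝ V) :
    pairing V (x ⊗ₜ y) F G = F x * G y := by
  rw [pairing_apply, TensorProduct.dualDistrib_apply]

theorem pairing_comm (t : V ⊗[ℝ] V) (F G : Module.Dual ℝ V) :
    pairing V (TensorProduct.comm ℝ V V t) F G = pairing V t G F := by
  induction t with
  | zero => simp
  | tmul x y => rw [TensorProduct.comm_tmul, pairing_tmul, pairing_tmul, mul_comm]
  | add x y hx hy => simp only [map_add, LinearMap.add_apply, hx, hy]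

theorem pairing_symm (t : SymSquare V) (F G : Module.Dual ℝ V) :
    pairing V t.1 F G = pairing V t.1 G F := by
  conv_lhs => rw [← show TensorProduct.comm ℝ V V t.1 = t.1 from t.2]
  rw [pairing_comm]

theorem pairing_map (f : V →ₗ[ℝ] W) (t : V ⊗[ℝ] V) (F G : Module.Dual ℝ W) :
    pairing W (TensorProduct.map f f t) F G = pairing V t (F ∘ₗ f) (G ∘ₗ f) := by
  induction t with
  | zero => simp
  | tmul x y => rw [TensorProduct.map_tmul, pairing_tmul, pairing_tmul]; rfl
  | add x y hx hy => simp only [map_add, LinearMap.add_apply, hx, hy]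

theorem symSquare_map_coe (f : V →ₗ[ℝ] W) (t : SymSquare V) :
    (SymSquare.map f t).1 = TensorProduct.map f f t.1 := rfl

theorem isPSD_iff (t : SymSquare V) : IsPSD t ↔ ∀ F, 0 ≤ pairing V t.1 F F := Iff.rfl

theorem IsPSD.map {t : SymSquare V} (ht : IsPSD t) (f : V →ₗ[ℝ] W) : IsPSD (SymSquare.map f t) := by
  rw [isPSD_iff] at *
  intro F
  rw [symSquare_map_coe, pairing_map]
  exact ht _

theorem isPSD_symSquareRep {G : Type*} [Group G] (ρ : Representation ℝ G V) (g : G)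
    (t : SymSquare V) : IsPSD (symSquareRep ρ g t) ↔ IsPSD t := by
  refine ⟨fun h => ?_, fun h => h.map (ρ g)⟩
  have h1 : symSquareRep ρ g⁻¹ (symSquareRep ρ g t) = t := by
    rw [← Module.End.mul_apply, ← map_mul, inv_mul_cancel, map_one, Module.End.one_apply]
  rw [← h1]
  exact h.map (ρ g⁻¹)

variable [FiniteDimensional ℝ V]

theorem eq_of_pairing {t t' : V ⊗[ℝ] V} (h : ∀ F G, pairing V t F G = pairing V t' F G) :
    t = t' := by
  let b := Module.finBasis ℝ V
  have key : ∀ (t : V ⊗[ℝ] V) p q, (b.tensorProduct b).repr t (p, q) =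
      pairing V t (b.coord p) (b.coord q) := by
    intro t p q
    induction t with
    | zero => simp
    | tmul x y => rw [pairing_tmul, Module.Basis.tensorProduct_repr_tmul_apply]; simp [mul_comm]
    | add x y hx hy => simp only [map_add, LinearMap.add_apply, Finsupp.add_apply, hx, hy]
  apply (b.tensorProduct b).repr.injective
  ext ⟨p, q⟩
  rw [key, key, h]

/-- The tensor given by a bilinear form on the dual space. -/
noncomputable def tensorOfForm (V : Type*) [AddCommGroup V] [Module ℝ V] [FiniteDimensional ℝ V] :
    (Module.Dual ℝ V →ₗ[ℝ] Module.Dual ℝ V →ₗ[ℝ] ℝ) →ₗ[ℝ] V ⊗[ℝ] V where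
  toFun β := ∑ p, ∑ q, β ((Module.finBasis ℝ V).coord p) ((Module.finBasis ℝ V).coord q) •
    (Module.finBasis ℝ V p ⊗ₜ[ℝ] Module.finBasis ℝ V q)
  map_add' β β' := by simp [add_smul, Finset.sum_add_distrib]
  map_smul' c β := by simp [mul_smul, Finset.smul_sum]

theorem pairing_tensorOfForm (β : Module.Dual ℝ V →ₗ[ℝ] Module.Dual ℝ V →ₗ[ℝ] ℝ)
    (F G : Module.Dual ℝ V) : pairing V (tensorOfForm V β) F G = β F G := by
  conv_rhs => rw [← (Module.finBasis ℝ V).sum_dual_apply_smul_coord F,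
    ← (Module.finBasis ℝ V).sum_dual_apply_smul_coord G]
  simp only [tensorOfForm, LinearMap.coe_mk, AddHom.coe_mk, map_sum, map_smul, LinearMap.sum_apply,
    LinearMap.smul_apply, pairing_tmul, smul_eq_mul]
  rw [Finset.sum_comm]
  refine Finset.sum_congr rfl fun q _ => ?_
  rw [Finset.mul_sum]
  exact Finset.sum_congr rfl fun p _ => by ring

/-- The symmetric tensors given by a linear family of symmetric bilinear forms. -/
noncomputable def symTensorOfForm {E : Type*} [AddCommGroup E] [Module ℝ E]
    (β : E →ₗ[ℝ] Module.Dual ℝ V →ₗ[ℝ] Module.Dual ℝ V →ₗ[ℝ] ℝ)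
    (hβ : ∀ X F G, β X F G = β X G F) : E →ₗ[ℝ] SymSquare V :=
  (tensorOfForm V ∘ₗ β).codRestrict (SymSquare V) fun X => eq_of_pairing fun F G => by
    rw [pairing_comm, LinearMap.comp_apply, pairing_tensorOfForm, pairing_tensorOfForm, hβ]

theorem pairing_symTensorOfForm {E : Type*} [AddCommGroup E] [Module ℝ E]
    (β : E →ₗ[ℝ] Module.Dual ℝ V →ₗ[ℝ] Module.Dual ℝ V →ₗ[ℝ] ℝ)
    (hβ : ∀ X F G, β X F G = β X G F) (X : E) (F G : Module.Dual ℝ V) :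
    pairing V (symTensorOfForm β hβ X).1 F G = β X F G := pairing_tensorOfForm _ _ _

/-- The preimage of the cone of positive semidefinite tensors is a spectrahedral cone. -/
theorem isSpectrahedralCone_preimage {E : Type*} [AddCommGroup E] [Module ℝ E]
    (Φ : E →ₗ[ℝ] SymSquare V) : IsSpectrahedralCone {X | IsPSD (Φ X)} := by
  let b := Module.finBasis ℝ V
  let A : E →ₗ[ℝ] SymMat (Module.finrank ℝ V) :=
    { toFun := fun X => ⟨Matrix.of fun p q => pairing V (Φ X).1 (b.coord p) (b.coord q), by
        ext p q
        exact pairing_symm _ _ _⟩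
      map_add' := fun X Y => by
        apply Subtype.ext
        ext p q
        simp
      map_smul' := fun c X => by
        apply Subtype.ext
        ext p q
        simp }
  refine ⟨_, A, Set.ext fun X => ?_⟩
  have hA : ∀ x : Fin (Module.finrank ℝ V) → ℝ, x ⬝ᵥ (A X).1.mulVec x =
      pairing V (Φ X).1 (∑ p, x p • b.coord p) (∑ p, x p • b.coord p) := by
    intro x
    simp only [map_sum, map_smul, LinearMap.sum_apply, LinearMap.smul_apply, smul_eq_mul, dotProduct,
      Matrix.mulVec, Finset.mul_sum]
    rw [Finset.sum_comm]
    refine Finset.sum_congr rfl fun q _ => Finset.sum_congr rfl fun p _ => ?_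
    change x p * (pairing V (Φ X).1 (b.coord p) (b.coord q) * x q) = _
    ring
  change IsPSD (Φ X) ↔ (A X).1.PosSemidef
  rw [isPSD_iff, Matrix.posSemidef_iff_dotProduct_mulVec]
  constructor
  · intro h
    refine ⟨SymMat.isHermitian _, fun x => ?_⟩
    rw [star_trivial, hA]
    exact h _
  · rintro ⟨-, h⟩ F
    have := h fun p => F (b p)
    rw [star_trivial, hA, b.sum_dual_apply_smul_coord] at this
    exact this

end Pairing

/-! ### Antisymmetrization, and the empty block -/

section Alt
variable {n k : ℕ}

/-- The unnormalized antisymmetrization in each of the two tensor factors. -/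
def alt (n k : ℕ) : TensorMat n k →ₗ[ℝ] TensorMat n k where
  toFun f := Matrix.of fun i j => ∑ σ : Equiv.Perm (Fin k), ∑ τ : Equiv.Perm (Fin k),
    ((Equiv.Perm.sign σ : ℤ) : ℝ) * ((Equiv.Perm.sign τ : ℤ) : ℝ) * f (i ∘ σ) (j ∘ τ)
  map_add' f g := by ext i j; simp [mul_add, Finset.sum_add_distrib]
  map_smul' c f := by ext i j; simp [Finset.mul_sum, mul_left_comm]

theorem alt_apply (f : TensorMat n k) (i j : Fin k → Fin n) : alt n k f i j =
    ∑ σ : Equiv.Perm (Fin k), ∑ τ : Equiv.Perm (Fin k),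
      ((Equiv.Perm.sign σ : ℤ) : ℝ) * ((Equiv.Perm.sign τ : ℤ) : ℝ) * f (i ∘ σ) (j ∘ τ) := rfl

theorem isAlt_alt (f : TensorMat n k) : IsAlt (alt n k f) := by
  refine ⟨fun σ i j => ?_, fun τ i j => ?_⟩
  · rw [alt_apply, alt_apply, Finset.mul_sum,
      ← Equiv.sum_comp (Equiv.mulLeft σ) fun σ' => ((Equiv.Perm.sign σ : ℤ) : ℝ) * _]
    refine Finset.sum_congr rfl fun σ' _ => ?_
    rw [Finset.mul_sum]
    refine Finset.sum_congr rfl fun τ _ => ?_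
    simp only [Equiv.coe_mulLeft, Equiv.Perm.sign_mul, Units.val_mul, Int.cast_mul, ← mul_assoc,
      sign_mul_sign, one_mul]
    rfl
  · rw [alt_apply, alt_apply, Finset.mul_sum]
    refine Finset.sum_congr rfl fun σ _ => ?_
    rw [Finset.mul_sum,
      ← Equiv.sum_comp (Equiv.mulLeft τ) fun τ' => ((Equiv.Perm.sign τ : ℤ) : ℝ) * _]
    refine Finset.sum_congr rfl fun τ' _ => ?_
    simp only [Equiv.coe_mulLeft, Equiv.Perm.sign_mul, Units.val_mul, Int.cast_mul]
    rw [show ∀ a b c d : ℝ, a * (b * (a * c) * d) = (a * a) * (b * c * d) by intros; ring,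
      sign_mul_sign, one_mul]
    rfl

theorem IsAlt.alt_eq {f : TensorMat n k} (hf : IsAlt f) :
    alt n k f = ((k.factorial : ℝ) * k.factorial) • f := by
  ext i j
  rw [alt_apply, Matrix.smul_apply, smul_eq_mul]
  have : ∀ σ τ : Equiv.Perm (Fin k), ((Equiv.Perm.sign σ : ℤ) : ℝ) *
      ((Equiv.Perm.sign τ : ℤ) : ℝ) * f (i ∘ σ) (j ∘ τ) = f i j := by
    intro σ τ
    rw [hf.1, hf.2, show ∀ a b c : ℝ, a * b * (a * (b * c)) = (a * a) * (b * b) * c by intros; ring,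
      sign_mul_sign, sign_mul_sign, one_mul, one_mul]
  simp [this, Fintype.card_perm, mul_assoc]

theorem sum_comp_perm (σ : Equiv.Perm (Fin k)) (F : (Fin k → Fin n) → ℝ) :
    ∑ i, F (i ∘ σ) = ∑ i, F i :=
  Equiv.sum_comp (Equiv.arrowCongr σ.symm (Equiv.refl (Fin n))) F

theorem tensorConj_apply_apply (U : Matrix (Fin n) (Fin n) ℝ) (f : TensorMat n k)
    (i j : Fin k → Fin n) : tensorConj k U f i j =
      ∑ p, ∑ q, tensorPow k U i p * tensorPow k U j q * f p q := by
  simp only [tensorConj_apply, Matrix.mul_apply, Matrix.transpose_apply, Finset.sum_mul]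
  rw [Finset.sum_comm]
  exact Finset.sum_congr rfl fun p _ => Finset.sum_congr rfl fun q _ => by ring

theorem tensorPow_comp (U : Matrix (Fin n) (Fin n) ℝ) (σ : Equiv.Perm (Fin k))
    (i j : Fin k → Fin n) : tensorPow k U (i ∘ σ) (j ∘ σ) = tensorPow k U i j := by
  rw [tensorPow_apply, tensorPow_apply]
  exact Equiv.prod_comp σ fun r => U (i r) (j r)

theorem tensorConj_comp (U : Matrix (Fin n) (Fin n) ℝ) (f : TensorMat n k)
    (σ τ : Equiv.Perm (Fin k)) (i j : Fin k → Fin n) : tensorConj k U f (i ∘ σ) (j ∘ τ) =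
      ∑ p, ∑ q, tensorPow k U i p * tensorPow k U j q * f (p ∘ σ) (q ∘ τ) := by
  rw [tensorConj_apply_apply, ← sum_comp_perm σ]
  refine Finset.sum_congr rfl fun p _ => ?_
  rw [← sum_comp_perm τ]
  exact Finset.sum_congr rfl fun q _ => by rw [tensorPow_comp, tensorPow_comp]

theorem alt_conj (U : Matrix (Fin n) (Fin n) ℝ) (f : TensorMat n k) :
    alt n k (tensorConj k U f) = tensorConj k U (alt n k f) := by
  ext i j
  rw [tensorConj_apply_apply, alt_apply]
  simp only [tensorConj_comp, alt_apply, Finset.mul_sum]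
  rw [Finset.sum_congr rfl fun σ _ => Finset.sum_comm, Finset.sum_comm]
  refine Finset.sum_congr rfl fun p _ => ?_
  rw [Finset.sum_congr rfl fun σ _ => Finset.sum_comm, Finset.sum_comm]
  refine Finset.sum_congr rfl fun q _ => Finset.sum_congr rfl fun σ _ =>
    Finset.sum_congr rfl fun τ _ => ?_
  ring

theorem tensorInner_alt (f g : TensorMat n k) :
    tensorInner n k (alt n k f) g = tensorInner n k f (alt n k g) := by
  simp only [tensorInner_apply, alt_apply, Finset.mul_sum, Finset.sum_mul]
  have h : ∀ F : (Fin k → Fin n) → (Fin k → Fin n) → Equiv.Perm (Fin k) → Equiv.Perm (Fin k) → ℝ,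
      ∑ i, ∑ j, ∑ σ, ∑ τ, F i j σ τ = ∑ σ, ∑ τ, ∑ i, ∑ j, F i j σ τ := by
    intro F
    rw [Finset.sum_congr rfl fun i _ => Finset.sum_comm, Finset.sum_comm]
    refine Finset.sum_congr rfl fun σ _ => ?_
    rw [Finset.sum_congr rfl fun i _ => Finset.sum_comm, Finset.sum_comm]
  rw [h, h, ← Equiv.sum_comp (Equiv.inv (Equiv.Perm (Fin k)))]
  refine Finset.sum_congr rfl fun σ _ => ?_
  rw [← Equiv.sum_comp (Equiv.inv (Equiv.Perm (Fin k)))]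
  refine Finset.sum_congr rfl fun τ _ => ?_
  rw [← sum_comp_perm σ]
  refine Finset.sum_congr rfl fun i _ => ?_
  rw [← sum_comp_perm τ]
  refine Finset.sum_congr rfl fun j _ => ?_
  have h1 : ∀ (i : Fin k → Fin n) (σ : Equiv.Perm (Fin k)), (i ∘ σ) ∘ ⇑σ⁻¹ = i :=
    fun i σ => funext fun r => by simp
  simp only [Equiv.inv_apply, Equiv.Perm.sign_inv, h1]
  ring

/-- At an injective i the only pairs of reorderings that meet the diagonal are those with σ = τ.
Their signs cancel, and there are k! of them. -/
theorem alt_diagonal {u : (Fin k → Fin n) → ℝ} (hu : u ∈ setFun n k) (i : Fin k → Fin n) :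
    alt n k (Matrix.diagonal u) i i = (k.factorial : ℝ) * u i := by
  by_cases hi : Function.Injective i
  · rw [alt_apply]
    have h1 : ∀ σ : Equiv.Perm (Fin k), ∑ τ : Equiv.Perm (Fin k),
        ((Equiv.Perm.sign σ : ℤ) : ℝ) * ((Equiv.Perm.sign τ : ℤ) : ℝ) *
          Matrix.diagonal u (i ∘ σ) (i ∘ τ) = u i := by
      intro σ
      rw [Finset.sum_eq_single σ]
      · rw [Matrix.diagonal_apply_eq, sign_mul_sign, one_mul, hu.1]
      · intro τ _ hτ
        rw [Matrix.diagonal_apply_ne, mul_zero]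
        intro h
        exact hτ (Equiv.ext fun r => (hi (congrFun h r)).symm)
      · simp
    simp [h1, Fintype.card_perm]
  · rw [(isAlt_alt _).eq_zero_left hi, hu.2 i hi, mul_zero]

theorem alt_single_self_eq_zero {p q : Fin k → Fin n}
    (h : Finset.univ.image p ≠ Finset.univ.image q) (i : Fin k → Fin n) :
    alt n k (Matrix.single p q 1) i i = 0 := by
  rw [alt_apply]
  refine Finset.sum_eq_zero fun σ _ => Finset.sum_eq_zero fun τ _ => ?_
  rw [Matrix.single_apply, if_neg, mul_zero]
  rintro ⟨rfl, rfl⟩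
  rw [image_comp_perm, image_comp_perm] at h
  exact h rfl

theorem tensorConj_permToOrthogonal (π : Equiv.Perm (Fin n)) (f : TensorMat n k)
    (i j : Fin k → Fin n) :
    tensorConj k (permToOrthogonal n π).1 f i j = f (⇑π⁻¹ ∘ i) (⇑π⁻¹ ∘ j) := by
  have h : ∀ i p : Fin k → Fin n, tensorPow k (permToOrthogonal n π).1 i p =
      if p = ⇑π⁻¹ ∘ i then 1 else 0 := by
    intro i p
    have h1 : ∀ a b, (permToOrthogonal n π).1 a b = if b = π⁻¹ a then 1 else 0 := by
      intro a b
      change (π⁻¹).permMatrix ℝ a b = _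
      simp [Equiv.Perm.permMatrix, PEquiv.toMatrix_apply, eq_comm]
    simp only [tensorPow_apply, h1, Finset.prod_ite_zero, Finset.prod_const_one, funext_iff,
      Finset.mem_univ, true_implies, Function.comp_apply]
  rw [tensorConj_apply_apply]
  simp [h]

end Alt

/-- The component of a tensor in a nonempty block vanishes if the tensor is supported on pairs of
tuples with the same entries. -/
theorem Block.comp_eq_zero {n k : ℕ} (J : Block n) (hJ : J.1.1.Nonempty) {f : TensorMat n k}
    (hf : ∀ i j, Finset.univ.image i ≠ Finset.univ.image j → f i j = 0) : J.comp f = 0 := by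
  funext i
  rw [J.comp_apply]
  split_ifs with h
  · rw [hf, mul_zero]; · rfl
    intro h1
    obtain ⟨p, hp⟩ := hJ
    have h2 := h1 ▸ h hp
    obtain ⟨r, -, hr⟩ := Finset.mem_image.1 h2
    rw [Function.comp_apply, Block.right] at hr
    split_ifs at hr with h3
    · exact J.notMem_right hp (hr ▸ J.swap_mem_right h3)
    · exact h3 (hr ▸ hp)
  · rfl

/-- The empty block. -/
def Block.empty (n : ℕ) : Block n := ⟨(∅, ∅), by simp⟩

theorem Block.eq_empty {n : ℕ} {J : Block n} (hJ : ¬ J.1.1.Nonempty) : J = Block.empty n := by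
  have h1 := Finset.not_nonempty_iff_eq_empty.1 hJ
  have h2 : J.1.2 = ∅ := by rw [← Finset.card_eq_zero, ← J.2.2, h1, Finset.card_empty]
  exact Subtype.ext (Prod.ext h1 h2)

theorem Block.comp_empty {n k : ℕ} (f : TensorMat n k) (i : Fin k → Fin n) :
    (Block.empty n).comp f i = f i i := by
  have h4 : (Block.empty n).1.1 = ∅ := rfl
  have h5 : (Block.empty n).1.2 = ∅ := rfl
  have h1 : (Block.empty n).left ∘ i = i := funext fun r => by simp [Block.left, h5]
  have h2 : (Block.empty n).right ∘ i = i := funext fun r => by simp [Block.right, h4]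
  have h3 : ∀ p, (Block.empty n).sign p = 1 := fun p => by simp [Block.sign, h5]
  rw [Block.comp_apply, h1, h2, h4, if_pos (Finset.empty_subset _)]
  simp [h3]

end SpectralLMI

/-! ### The representation W, the map P and the lift of φ -/

namespace SpectralLMI

section Rep
variable {n k m : ℕ}

/-- The representation of `O(n)` on `m` copies of `(ℝ^n)^{⊗ k} ⊗ (ℝ^n)^{⊗ k}`. -/
def tensorRep (n k m : ℕ) :
    Representation ℝ (Matrix.orthogonalGroup (Fin n) ℝ) (Fin m → TensorMat n k) where
  toFun U := LinearMap.pi fun s => tensorConj k U.1 ∘ₗ LinearMap.proj s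
  map_one' := by
    refine LinearMap.ext fun w => funext fun s => ?_
    exact LinearMap.congr_fun tensorConj_one (w s)
  map_mul' U U' := by
    refine LinearMap.ext fun w => funext fun s => ?_
    exact tensorConj_mul U.1 U'.1 (w s)

theorem tensorRep_apply (U : Matrix.orthogonalGroup (Fin n) ℝ) (w : Fin m → TensorMat n k)
    (s : Fin m) : tensorRep n k m U w s = tensorConj k U.1 (w s) := rfl

theorem isContinuousRep_tensorRep (n k m : ℕ) : IsContinuousRep (tensorRep n k m) := by
  intro w f
  refine (LinearMap.continuous_of_finiteDimensional f).comp ?_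
  refine continuous_pi fun s => continuous_matrix fun i j => ?_
  have h : ∀ a b, Continuous fun U : Matrix.orthogonalGroup (Fin n) ℝ => U.1 a b :=
    fun a b => continuous_subtype_val.matrix_elem a b
  simp only [tensorRep_apply, tensorConj_apply_apply, tensorPow_apply]
  exact continuous_finsetSum _ fun p _ => continuous_finsetSum _ fun q _ =>
    ((continuous_finsetProd _ fun r _ => h _ _).mul
      (continuous_finsetProd _ fun r _ => h _ _)).mul continuous_const

/-- The components of a linear functional on `m` copies of the space of tensors. -/
def coeffs (s : Fin m) : Module.Dual ℝ (Fin m → TensorMat n k) →ₗ[ℝ] TensorMat n k where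
  toFun F := Matrix.of fun i j => F (Pi.single s (Matrix.single i j 1))
  map_add' F G := by ext i j; simp
  map_smul' c F := by ext i j; simp

theorem coeffs_apply (s : Fin m) (F : Module.Dual ℝ (Fin m → TensorMat n k))
    (i j : Fin k → Fin n) : coeffs s F i j = F (Pi.single s (Matrix.single i j 1)) := rfl

theorem tensorInner_coeffs (s : Fin m) (F : Module.Dual ℝ (Fin m → TensorMat n k))
    (f : TensorMat n k) : tensorInner n k (coeffs s F) f = F (Pi.single s f) := by
  conv_rhs => rw [Matrix.matrix_eq_sum_single f]
  have h : ∀ i j, Matrix.single i j (f i j) = f i j • (Matrix.single i j 1 : TensorMat n k) :=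
    fun i j => by rw [Matrix.smul_single, smul_eq_mul, mul_one]
  have h2 : ∀ g : TensorMat n k, F (Pi.single s g) = (F ∘ₗ LinearMap.single ℝ _ s) g :=
    fun g => rfl
  simp only [h, h2, map_sum, map_smul, tensorInner_apply, coeffs_apply, smul_eq_mul]
  exact Finset.sum_congr rfl fun i _ => Finset.sum_congr rfl fun j _ => mul_comm _ _

theorem sum_tensorInner_coeffs (F : Module.Dual ℝ (Fin m → TensorMat n k))
    (w : Fin m → TensorMat n k) : ∑ s, tensorInner n k (coeffs s F) (w s) = F w := by
  simp only [tensorInner_coeffs, ← map_sum, Finset.univ_sum_single]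

/-- The matrix `coeffs s F` represents the s-th component of F through the inner product. As this
inner product is invariant, pulling F back along U moves the representing matrix by the inverse of
U. -/
theorem tensorConj_coeffs (U : Matrix.orthogonalGroup (Fin n) ℝ) (s : Fin m)
    (F : Module.Dual ℝ (Fin m → TensorMat n k)) :
    tensorConj k U.1 (coeffs s (F ∘ₗ tensorRep n k m U)) = coeffs s F := by
  have h1 : ∀ f, tensorInner n k (coeffs s (F ∘ₗ tensorRep n k m U)) f =
      tensorInner n k (coeffs s F) (tensorConj k U.1 f) := by
    intro f
    rw [tensorInner_coeffs, tensorInner_coeffs, LinearMap.comp_apply]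
    congr 1
    funext t
    rw [tensorRep_apply]
    rcases eq_or_ne t s with rfl | h
    · simp
    · simp [Pi.single_eq_of_ne h]
  have h2 : ∀ f : TensorMat n k, tensorConj k U.1 (tensorConj k U.1.transpose f) = f := by
    intro f
    rw [← tensorConj_mul, orthogonal_mul_transpose, tensorConj_one, LinearMap.id_apply]
  have h3 : ∀ f, tensorInner n k (tensorConj k U.1 (coeffs s (F ∘ₗ tensorRep n k m U))) f =
      tensorInner n k (coeffs s F) f := by
    intro f
    conv_lhs => rw [← h2 f]
    rw [tensorInner_conj (orthogonal_transpose_mul U), h1, h2]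
  ext i j
  have := h3 (Matrix.single i j 1)
  simpa [tensorInner_apply, Matrix.single_apply, ite_and] using this

/-- The antisymmetrized components of a linear functional. -/
def altCoeffs (s : Fin m) : Module.Dual ℝ (Fin m → TensorMat n k) →ₗ[ℝ] TensorMat n k :=
  alt n k ∘ₗ coeffs s

theorem altCoeffs_apply (s : Fin m) (F : Module.Dual ℝ (Fin m → TensorMat n k)) :
    altCoeffs s F = alt n k (coeffs s F) := rfl

theorem tensorConj_altCoeffs (U : Matrix.orthogonalGroup (Fin n) ℝ) (s : Fin m)
    (F : Module.Dual ℝ (Fin m → TensorMat n k)) :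
    tensorConj k U.1 (altCoeffs s (F ∘ₗ tensorRep n k m U)) = altCoeffs s F := by
  rw [altCoeffs_apply, altCoeffs_apply, ← alt_conj, tensorConj_coeffs]

end Rep

section Main
variable {n k m : ℕ} {V : Type*} [AddCommGroup V] [Module ℝ V]
  {ρ : Representation ℝ (Equiv.Perm (Fin n)) V}
  (ι : Fin m → V →ₗ[ℝ] ((Fin k → Fin n) → ℝ))

/-- The kernels of an equivariant map to symmetric tensors with respect to coordinates. -/
noncomputable def mapKernel (φ : (permRep n).IntertwiningMap (symSquareRep ρ)) (s t : Fin m)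
    (a : Fin n → ℝ) (i j : Fin k → Fin n) : ℝ :=
  pairing V (φ a).1 (LinearMap.proj i ∘ₗ ι s) (LinearMap.proj j ∘ₗ ι t)

variable {ι}

theorem isSetKernel_mapKernel (hι : ∀ s, ι s ∈ homSetFun k ρ)
    (φ : (permRep n).IntertwiningMap (symSquareRep ρ)) (s t : Fin m) :
    IsSetKernel (mapKernel ι φ s t) where
  add a b i j := by
    simp only [mapKernel, map_add, Submodule.coe_add, LinearMap.add_apply]
  smul c a i j := by
    simp only [mapKernel, map_smul, Submodule.coe_smul, LinearMap.smul_apply, smul_eq_mul]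
  perm π a i j := by
    have h1 : ∀ (s : Fin m) (i : Fin k → Fin n), (LinearMap.proj (⇑π ∘ i) ∘ₗ ι s : V →ₗ[ℝ] ℝ) =
        (LinearMap.proj i ∘ₗ ι s) ∘ₗ ρ π⁻¹ := by
      intro s i
      ext v
      change ι s v (π ∘ i) = ι s (ρ π⁻¹ v) i
      rw [(hι s).1, tupRep_apply, inv_inv]
    have h2 : a ∘ π = permRep n π⁻¹ a := by
      funext p
      change a (π p) = a ((π⁻¹)⁻¹ p)
      rw [inv_inv]
    have h3 : φ (permRep n π⁻¹ a) = symSquareRep ρ π⁻¹ (φ a) := φ.isIntertwining _ _ π⁻¹ a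
    rw [mapKernel, mapKernel, h1, h1, h2, h3, ← pairing_map]
    rfl
  left a σ i j := by
    have h : (LinearMap.proj (i ∘ σ) ∘ₗ ι s : V →ₗ[ℝ] ℝ) = LinearMap.proj i ∘ₗ ι s :=
      LinearMap.ext fun v => ((hι s).2 v).1 σ i
    rw [mapKernel, mapKernel, h]
  right a σ i j := by
    have h : (LinearMap.proj (j ∘ σ) ∘ₗ ι t : V →ₗ[ℝ] ℝ) = LinearMap.proj j ∘ₗ ι t :=
      LinearMap.ext fun v => ((hι t).2 v).1 σ j
    rw [mapKernel, mapKernel, h]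
  zero_left a i j hi := by
    have h : (LinearMap.proj i ∘ₗ ι s : V →ₗ[ℝ] ℝ) = 0 :=
      LinearMap.ext fun v => ((hι s).2 v).2 i hi
    rw [mapKernel, h, map_zero, LinearMap.zero_apply]
  zero_right a i j hj := by
    have h : (LinearMap.proj j ∘ₗ ι t : V →ₗ[ℝ] ℝ) = 0 :=
      LinearMap.ext fun v => ((hι t).2 v).2 j hj
    rw [mapKernel, h, map_zero]

variable (ι) in
/-- The functional on `V` given by the component of a functional on tensors in a block. -/
noncomputable def blockFunctional (J : Block n) (F : Module.Dual ℝ (Fin m → TensorMat n k)) :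
    Module.Dual ℝ V := ∑ s, ∑ i, J.comp (altCoeffs s F) i • (LinearMap.proj i ∘ₗ ι s)

theorem blockFunctional_apply (J : Block n) (F : Module.Dual ℝ (Fin m → TensorMat n k)) (v : V) :
    blockFunctional ι J F v = ∑ s, ∑ i, J.comp (altCoeffs s F) i * ι s v i := by
  simp [blockFunctional]

theorem pairing_blockFunctional (φ : (permRep n).IntertwiningMap (symSquareRep ρ)) (J : Block n)
    (F G : Module.Dual ℝ (Fin m → TensorMat n k)) (a : Fin n → ℝ) :
    pairing V (φ a).1 (blockFunctional ι J F) (blockFunctional ι J G) =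
      ∑ s, ∑ t, kernelForm (mapKernel ι φ s t) a (J.comp (altCoeffs s F))
        (J.comp (altCoeffs t G)) := by
  rw [blockFunctional, map_sum, LinearMap.sum_apply]
  refine Finset.sum_congr rfl fun s _ => ?_
  rw [blockFunctional, map_sum]
  refine Finset.sum_congr rfl fun t _ => ?_
  rw [map_sum (pairing V (φ a).1), LinearMap.sum_apply, kernelForm]
  refine Finset.sum_congr rfl fun i _ => ?_
  rw [map_smul, LinearMap.smul_apply, map_sum, smul_eq_mul, Finset.mul_sum]
  refine Finset.sum_congr rfl fun j _ => ?_
  rw [map_smul, smul_eq_mul, mapKernel]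
  ring

/-- An equivariant family of symmetric bilinear forms on the dual space of the space of tensors
that is a combination over the blocks of the given equivariant map at diagonal matrices. -/
theorem exists_form (hι : ∀ s, ι s ∈ homSetFun k ρ)
    (φ : (permRep n).IntertwiningMap (symSquareRep ρ)) :
    ∃ β : SymMat n →ₗ[ℝ] Module.Dual ℝ (Fin m → TensorMat n k) →ₗ[ℝ]
        Module.Dual ℝ (Fin m → TensorMat n k) →ₗ[ℝ] ℝ,
      (∀ X F G, β X F G = β X G F) ∧
      (∀ U X F G, β (conjRep n U X) F G =
        β X (F ∘ₗ tensorRep n k m U) (G ∘ₗ tensorRep n k m U)) ∧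
      ∀ a F G, β (diag a) F G = ∑ J : Block n, (1 / 2 : ℝ) ^ J.1.1.card *
        pairing V (φ a).1 (blockFunctional ι J F) (blockFunctional ι J G) := by
  choose L hL using fun s t => (isSetKernel_mapKernel hι φ s t).liftable
  let β₀ : SymMat n →ₗ[ℝ] Module.Dual ℝ (Fin m → TensorMat n k) →ₗ[ℝ]
      Module.Dual ℝ (Fin m → TensorMat n k) →ₗ[ℝ] ℝ :=
    { toFun := fun X => ∑ s, ∑ t, (L s t X).compl₁₂ (altCoeffs s) (altCoeffs t)
      map_add' := fun X Y => LinearMap.ext₂ fun F G => by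
        simp [Finset.sum_add_distrib]
      map_smul' := fun c X => LinearMap.ext₂ fun F G => by
        simp [Finset.mul_sum] }
  have hβ₀ : ∀ X F G, β₀ X F G = ∑ s, ∑ t, L s t X (altCoeffs s F) (altCoeffs t G) := by
    intro X F G
    simp [β₀]
  have hconj : ∀ U X F G, β₀ (conjRep n U X) F G =
        β₀ X (F ∘ₗ tensorRep n k m U) (G ∘ₗ tensorRep n k m U) := by
    intro U X F G
    rw [hβ₀, hβ₀]
    refine Finset.sum_congr rfl fun s _ => Finset.sum_congr rfl fun t _ => ?_
    rw [← (hL s t).conj U X, tensorConj_altCoeffs, tensorConj_altCoeffs]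
  have hdiag : ∀ a F G, β₀ (diag a) F G = ∑ J : Block n, (1 / 2 : ℝ) ^ J.1.1.card *
        pairing V (φ a).1 (blockFunctional ι J F) (blockFunctional ι J G) := by
    intro a F G
    rw [hβ₀]
    have h1 : ∀ s t, L s t (diag a) (altCoeffs s F) (altCoeffs t G) = ∑ J : Block n,
        (1 / 2 : ℝ) ^ J.1.1.card * kernelForm (mapKernel ι φ s t) a (J.comp (altCoeffs s F))
          (J.comp (altCoeffs t G)) :=
      fun s t => (hL s t).block a _ _ (isAlt_alt _) (isAlt_alt _)
    simp only [h1, pairing_blockFunctional, Finset.mul_sum]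
    rw [Finset.sum_congr rfl fun s _ => Finset.sum_comm, Finset.sum_comm]
  -- The chosen lifts need not be symmetric in s and t, so the form is symmetrized. At diagonal
  -- matrices nothing changes, since there it is a combination of pullbacks of the symmetric tensor
  -- φ(a).
  let β : SymMat n →ₗ[ℝ] Module.Dual ℝ (Fin m → TensorMat n k) →ₗ[ℝ]
      Module.Dual ℝ (Fin m → TensorMat n k) →ₗ[ℝ] ℝ :=
    { toFun := fun X => (1 / 2 : ℝ) • (β₀ X + (β₀ X).flip)
      map_add' := fun X Y => LinearMap.ext₂ fun F G => by simp; ring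
      map_smul' := fun c X => LinearMap.ext₂ fun F G => by simp; ring }
  have hβ : ∀ X F G, β X F G = 1 / 2 * (β₀ X F G + β₀ X G F) := fun _ _ _ => rfl
  refine ⟨β, fun X F G => ?_, fun U X F G => ?_, fun a F G => ?_⟩
  · rw [hβ, hβ, add_comm]
  · rw [hβ, hβ, hconj, hconj]
  · have h2 : β₀ (diag a) G F = β₀ (diag a) F G := by
      rw [hdiag, hdiag]
      exact Finset.sum_congr rfl fun J _ => by rw [pairing_symm]
    rw [hβ, h2, ← hdiag]
    ring

/-- The map from tensors to functions of tuples that restricts the antisymmetrization of a tensor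
to the diagonal. -/
noncomputable def diagPart (n k m : ℕ) :
    (Fin m → TensorMat n k) →ₗ[ℝ] (Fin m → (Fin k → Fin n) → ℝ) where
  toFun w s i := ((k.factorial : ℝ) * k.factorial * k.factorial)⁻¹ * alt n k (w s) i i
  map_add' w w' := by
    funext s i
    simp [mul_add]
  map_smul' c w := by
    funext s i
    simp [mul_left_comm]

theorem diagPart_apply (w : Fin m → TensorMat n k) (s : Fin m) (i : Fin k → Fin n) :
    diagPart n k m w s i =
      ((k.factorial : ℝ) * k.factorial * k.factorial)⁻¹ * alt n k (w s) i i := rfl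

theorem diagPart_perm (π : Equiv.Perm (Fin n)) (w : Fin m → TensorMat n k) :
    diagPart n k m (tensorRep n k m (permToOrthogonal n π) w) =
      fun s => tupRep n k π (diagPart n k m w s) := by
  funext s i
  rw [tupRep_apply, diagPart_apply, diagPart_apply, tensorRep_apply, alt_conj,
    tensorConj_permToOrthogonal]

/-- This provides the section of P and explains the constant in `diagPart`: the second
antisymmetrization contributes (k!)², and the diagonal of the first contributes k!. -/
theorem diagPart_alt_diagonal (hι : ∀ s, ι s ∈ homSetFun k ρ) (v : V) :
    diagPart n k m (fun s => alt n k (Matrix.diagonal (ι s v))) = fun s => ι s v := by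
  funext s i
  have h : (k.factorial : ℝ) ≠ 0 := by exact_mod_cast k.factorial_ne_zero
  rw [diagPart_apply, (isAlt_alt _).alt_eq, Matrix.smul_apply, alt_diagonal ((hι s).2 v),
    smul_eq_mul]
  field_simp

/-- A functional factoring through `diagPart` sees only entries whose two index tuples have the same
set of labels, whereas a nonempty block uses only entries with different sets. -/
theorem blockFunctional_comp_diagPart (J : Block n) (hJ : J.1.1.Nonempty)
    (F : Module.Dual ℝ (Fin m → (Fin k → Fin n) → ℝ)) :
    blockFunctional ι J (F ∘ₗ diagPart n k m) = 0 := by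
  have h1 : ∀ (s : Fin m) i j, Finset.univ.image i ≠ Finset.univ.image j →
      coeffs s (F ∘ₗ diagPart n k m) i j = 0 := by
    intro s i j hij
    rw [coeffs_apply, LinearMap.comp_apply]
    convert map_zero F
    funext t p
    rw [diagPart_apply]
    rcases eq_or_ne t s with rfl | h
    · rw [Pi.single_eq_same, alt_single_self_eq_zero hij, mul_zero]; rfl
    · rw [Pi.single_eq_of_ne h, map_zero]; simp
  have h2 : ∀ s : Fin m, J.comp (altCoeffs s (F ∘ₗ diagPart n k m)) = 0 := by
    intro s
    refine J.comp_eq_zero hJ fun i j hij => ?_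
    rw [altCoeffs_apply, alt_apply]
    refine Finset.sum_eq_zero fun σ _ => Finset.sum_eq_zero fun τ _ => ?_
    rw [h1, mul_zero]
    rwa [image_comp_perm, image_comp_perm]
  simp [blockFunctional, h2]

/-- The empty block reads the diagonal of the antisymmetrized coefficients. Since `alt` is
self-adjoint, this is evaluation of F at the section of P, so pulling a functional on V back by P
and taking its empty block recovers it. -/
theorem blockFunctional_empty (F : Module.Dual ℝ (Fin m → TensorMat n k)) (v : V) :
    blockFunctional ι (Block.empty n) F v = F fun s => alt n k (Matrix.diagonal (ι s v)) := by
  rw [blockFunctional_apply, ← sum_tensorInner_coeffs]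
  refine Finset.sum_congr rfl fun s _ => ?_
  rw [← tensorInner_alt, tensorInner_apply]
  refine Finset.sum_congr rfl fun i _ => ?_
  rw [Block.comp_empty, Finset.sum_eq_single i]
  · rw [Matrix.diagonal_apply_eq, altCoeffs_apply]
  · intro j _ hj
    rw [Matrix.diagonal_apply_ne _ (Ne.symm hj), mul_zero]
  · simp

theorem exists_conjRep_diag_eq (X : SymMat n) :
    ∃ U : Matrix.orthogonalGroup (Fin n) ℝ, conjRep n U (diag (eigenvalueVector X)) = X := by
  have hX := SymMat.isHermitian X
  refine ⟨hX.eigenvectorUnitary, Subtype.ext ?_⟩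
  rw [conjRep_coe]
  have h := hX.spectral_theorem
  rw [Unitary.conjStarAlgAut_apply] at h
  exact h.symm

end Main

theorem IsShort.exists_rep {n : ℕ} {V : Type*} [AddCommGroup V] [Module ℝ V]
    [FiniteDimensional ℝ V] {ρ : Representation ℝ (Equiv.Perm (Fin n)) V} (hρ : IsShort ρ) :
    ∃ (W : Type) (_ : AddCommGroup W) (_ : Module ℝ W) (_ : FiniteDimensional ℝ W)
      (ρW : Representation ℝ (Matrix.orthogonalGroup (Fin n) ℝ) W)
      (P : Representation.IntertwiningMap (ρW.comp (permToOrthogonal n)) ρ),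
      IsContinuousRep ρW ∧ Function.Surjective P ∧
      ∀ φ : (permRep n).IntertwiningMap (symSquareRep ρ),
        ∃ Φ : (conjRep n).IntertwiningMap (symSquareRep ρW),
          (∀ a : Fin n → ℝ, SymSquare.map P.toLinearMap (Φ (diag a)) = φ a) ∧
          ∀ X : SymMat n, IsPSD (Φ X) ↔ IsPSD (φ (eigenvalueVector X)) := by
  obtain ⟨m, ι, hι, r, hr, hrι⟩ := hρ.exists_embedding
  let k := n / 2
  let P₀ : (Fin m → TensorMat n k) →ₗ[ℝ] V := r ∘ₗ diagPart n k m
  have hP₀ : ∀ v, P₀ (fun s => alt n k (Matrix.diagonal (ι s v))) = v := by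
    intro v
    change r (diagPart n k m _) = v
    rw [diagPart_alt_diagonal hι, hrι]
  let P : Representation.IntertwiningMap ((tensorRep n k m).comp (permToOrthogonal n)) ρ :=
    ⟨P₀, fun π => LinearMap.ext fun w => by
      change r (diagPart n k m (tensorRep n k m (permToOrthogonal n π) w)) = ρ π (P₀ w)
      rw [diagPart_perm, hr]
      rfl⟩
  refine ⟨Fin m → TensorMat n k, inferInstance, inferInstance, inferInstance, tensorRep n k m, P,
    isContinuousRep_tensorRep n k m, fun v => ⟨_, hP₀ v⟩, fun φ => ?_⟩
  obtain ⟨β, hsymm, hconj, hdiag⟩ := exists_form hι φ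
  let Φ₀ := symTensorOfForm β hsymm
  have hΦ : ∀ U X, Φ₀ (conjRep n U X) = symSquareRep (tensorRep n k m) U (Φ₀ X) := by
    intro U X
    refine Subtype.ext (eq_of_pairing fun F G => ?_)
    rw [pairing_symTensorOfForm, hconj]
    change _ = pairing _ (TensorProduct.map (tensorRep n k m U) (tensorRep n k m U) (Φ₀ X).1) F G
    rw [pairing_map, pairing_symTensorOfForm]
  -- For functionals pulled back along P only the empty block survives, and its weight is 1.
  have hP : ∀ a, SymSquare.map P₀ (Φ₀ (diag a)) = φ a := by
    intro a
    refine Subtype.ext (eq_of_pairing fun F G => ?_)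
    rw [symSquare_map_coe, pairing_map, pairing_symTensorOfForm, hdiag,
      Finset.sum_eq_single (Block.empty n)]
    · have h1 : ∀ F : Module.Dual ℝ V, blockFunctional ι (Block.empty n) (F ∘ₗ P₀) = F := by
        intro F
        ext v
        rw [blockFunctional_empty, LinearMap.comp_apply, hP₀]
      rw [h1, h1, show (Block.empty n).1.1.card = 0 from rfl, pow_zero, one_mul]
    · intro J _ hJ
      have hJ' : J.1.1.Nonempty := by
        by_contra h
        exact hJ (Block.eq_empty h)
      have h2 : blockFunctional ι J (F ∘ₗ P₀) = 0 :=
        blockFunctional_comp_diagPart J hJ' (F ∘ₗ r)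
      rw [h2, map_zero, LinearMap.zero_apply, mul_zero]
    · simp
  -- One direction pushes Φ(diag a) forward along P; the other writes it as a sum over blocks with
  -- positive weights of values of the form φ(a).
  have hpsd : ∀ a, IsPSD (Φ₀ (diag a)) ↔ IsPSD (φ a) := by
    intro a
    constructor
    · intro h
      rw [← hP]
      exact h.map P₀
    · intro h
      rw [isPSD_iff] at *
      intro F
      rw [pairing_symTensorOfForm, hdiag]
      exact Finset.sum_nonneg fun J _ => mul_nonneg (by positivity) (h _)
  refine ⟨⟨Φ₀, fun U => LinearMap.ext fun X => hΦ U X⟩, hP, fun X => ?_⟩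
  change IsPSD (Φ₀ X) ↔ _
  obtain ⟨U, hU⟩ := exists_conjRep_diag_eq X
  rw [← hpsd]
  conv_lhs => rw [← hU, hΦ, isPSD_symSquareRep]

end SpectralLMI

open SpectralLMI
theorem theorem2p2 {n : ℕ} {V : Type*} [AddCommGroup V] [Module ℝ V] [FiniteDimensional ℝ V]
    (ρ : Representation ℝ (Equiv.Perm (Fin n)) V) (hρ : IsShort ρ) :
    -- the spectral set of the preimage of the PSD cone is a spectrahedral cone
    (∀ φ : (permRep n).IntertwiningMap (symSquareRep ρ),
      IsSpectrahedralCone (spectralSet {a : Fin n → ℝ | IsPSD (φ a)})) ∧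
    -- the more precise version, where `W` and `P` depend only on `V`
    ∃ (W : Type) (_ : AddCommGroup W) (_ : Module ℝ W) (_ : FiniteDimensional ℝ W)
      (ρW : Representation ℝ (Matrix.orthogonalGroup (Fin n) ℝ) W)
      (P : Representation.IntertwiningMap (ρW.comp (permToOrthogonal n)) ρ),
      IsContinuousRep ρW ∧ Function.Surjective P ∧
      ∀ φ : (permRep n).IntertwiningMap (symSquareRep ρ),
        ∃ Φ : (conjRep n).IntertwiningMap (symSquareRep ρW),
          (∀ a : Fin n → ℝ, SymSquare.map P.toLinearMap (Φ (diag a)) = φ a) ∧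
          ∀ X : SymMat n, IsPSD (Φ X) ↔ IsPSD (φ (eigenvalueVector X)) := by
  refine ⟨fun φ => ?_, hρ.exists_rep⟩
  obtain ⟨W, _, _, _, ρW, P, -, -, h⟩ := hρ.exists_rep
  obtain ⟨Φ, -, hΦ⟩ := h φ
  have h1 : spectralSet {a : Fin n → ℝ | IsPSD (φ a)} = {X | IsPSD (Φ.toLinearMap X)} :=
    Set.ext fun X => (hΦ X).symm
  rw [h1]
  exact isSpectrahedralCone_preimage Φ.toLinearMap
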